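/- Let $n\ge 1$ and $0<\alpha<n$. Cubes $Q\subset\mathbb R^n$ have sides parallel to the axes, and $$I_\alpha f(x)=\int_{\mathbb R^n}\frac{f(y)}{|x-y|^{n-\alpha}}\,dy .$$ For a non-negative locally integrable or measurable function $u$ write $u(E)=\int_E u\,dx$ and $\|g\|_{L^{q,\infty}(u)}=\sup_{t>0}t\,u(\{|g|>t\})^{1/q}$. A weight $w$ is a measurable function that is positive almost everywhere. For $p>1$, with $p'=p/(p-1)$, put $$[w]_{A_{p,q}}=\sup_Q\Big(\frac1{|Q|}\int_Q w^q\,dx\Big)\Big(\frac1{|Q|}\int_Q w^{-p'}\,dx\Big)^{q/p'},$$ and let $[w]_{A_{1,q}}$ be the smallest $c$ such that $\frac1{|Q|}\int_Q w^q\,dx\le c\,\operatorname{ess\,inf}_Q w^q$ for all cubes $Q$; write $w\in A_{p,q}$ if $[w]_{A_{p,q}}<\infty$. (1) Let $1\le p<n/\alpha$ and $1/q=1/p-\alpha/n$. There is a constant $c=c(n,\alpha,p)$ such that for every $w\in A_{p,q}$ and every $f$ with $wf\in L^p(\mathbb R^n)$, the integral defining $I_\alpha f(x)$ converges absolutely for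 almost every $x$ and $$\|I_\alpha f\|_{L^{q,\infty}(w^q)}\le c\,[w]_{A_{p,q}}^{1-\alpha/n}\,\|wf\|_{L^p}.$$ (2) For every such $p,q$ the exponent $1-\alpha/n$ is sharp: for no real $\gamma<1-\alpha/n$ is there a constant $c$ such that $\|I_\alpha f\|_{L^{q,\infty}(w^q)}\le c\,[w]_{A_{p,q}}^{\gamma}\|wf\|_{L^p}$ for all $w\in A_{p,q}$ and all $f$ with $wf\in L^p(\mathbb R^n)$. (3) Let $Mu(x)=\sup_{Q\ni x}\frac1{|Q|}\int_Q |u|\,dy$. There is a constant $c=c(n,\alpha)$ such that for every non-negative locally integrable $u$ and every measurable $f$ with $\int_{\mathbb R^n}|f|\,(Mu)^{1-\alpha/n}\,dx<\infty$, the integral defining $I_\alpha f(x)$ converges absolutely for $u\,dx$-almost every $x$ and $$\|I_\alpha f\|_{L^{(n/\alpha)',\infty}(u)}\le c\int_{\mathbb R^n}|f|\,(Mu)^{1-\alpha/n}\,dx .$$ -/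

import Mathlib

open MeasureTheory
open scoped ENNReal NNReal

noncomputable section

namespace FractionalIntegral

/-- The closed cube in `ℝⁿ` with sides parallel to the axes, lower corner `a` and side length `l`. -/
def cube {n : ℕ} (a : EuclideanSpace ℝ (Fin n)) (l : ℝ) : Set (EuclideanSpace ℝ (Fin n)) :=
  {x | ∀ i, x i ∈ Set.Icc (a i) (a i + l)}

/-- The average `|Q|⁻¹ ∫_Q g dx` of a nonnegative function. -/
def avg {n : ℕ} (Q : Set (EuclideanSpace ℝ (Fin n))) (g : EuclideanSpace ℝ (Fin n) → ℝ≥0∞) : ℝ≥0∞ :=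
  (volume Q)⁻¹ * ∫⁻ x in Q, g x

/-- The Riesz potential `I_α f(x) = ∫ f(y) / |x - y|^(n - α) dy`. -/
def rieszPotential {n : ℕ} (α : ℝ) (f : EuclideanSpace ℝ (Fin n) → ℂ)
    (x : EuclideanSpace ℝ (Fin n)) : ℂ :=
  ∫ y, f y / ((‖x - y‖ ^ ((n : ℝ) - α) : ℝ) : ℂ)

/-- The integral defining `I_α f(x)` converges absolutely. -/
def RieszConverges {n : ℕ} (α : ℝ) (f : EuclideanSpace ℝ (Fin n) → ℂ)
    (x : EuclideanSpace ℝ (Fin n)) : Prop :=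
  Integrable (fun y => f y / ((‖x - y‖ ^ ((n : ℝ) - α) : ℝ) : ℂ)) volume

/-- The weak norm `‖g‖_{L^{q,∞}(u)} = sup_{t > 0} t · u({x : |g(x)| > t})^(1/q)`,
where `u(E) = ∫_E u dx`. The index `t = 0` contributes nothing. -/
def weakNorm {n : ℕ} (q : ℝ) (u : EuclideanSpace ℝ (Fin n) → ℝ≥0∞)
    (g : EuclideanSpace ℝ (Fin n) → ℂ) : ℝ≥0∞ :=
  ⨆ t : ℝ≥0, (t : ℝ≥0∞) * (volume.withDensity u {x | t < ‖g x‖₊}) ^ (1 / q)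

/-- The power `w ^ s` of a weight, with values in `[0, ∞]`. -/
def wpow {n : ℕ} (w : EuclideanSpace ℝ (Fin n) → ℝ) (s : ℝ)
    (x : EuclideanSpace ℝ (Fin n)) : ℝ≥0∞ :=
  ENNReal.ofReal (w x) ^ s

/-- The constant `[w]_{A_{p,q}}`, with values in `[0, ∞]`. For `p = 1` it is the smallest `c` such
that the average of `w^q` over `Q` is at most `c · ess inf_Q w^q` for all cubes `Q`; for `p > 1` it
is the supremum over all cubes of `(⨍_Q w^q) (⨍_Q w^(-p'))^(q/p')`. -/
def apqConst {n : ℕ} (p q : ℝ) (w : EuclideanSpace ℝ (Fin n) → ℝ) : ℝ≥0∞ :=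
  if p = 1 then
    sInf {c : ℝ≥0∞ | ∀ (a : EuclideanSpace ℝ (Fin n)) (l : ℝ), 0 < l →
      avg (cube a l) (wpow w q) ≤ c * essInf (wpow w q) (volume.restrict (cube a l))}
  else
    ⨆ (a : EuclideanSpace ℝ (Fin n)) (l : ℝ) (_ : 0 < l),
      avg (cube a l) (wpow w q) *
        avg (cube a l) (wpow w (-p.conjExponent)) ^ (q / p.conjExponent)

/-- `w` is a weight in the class `A_{p,q}`. -/
structure MemApq {n : ℕ} (p q : ℝ) (w : EuclideanSpace ℝ (Fin n) → ℝ) : Prop where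
  aemeasurable : AEMeasurable w volume
  pos : ∀ᵐ x, 0 < w x
  const_lt_top : apqConst p q w < ∞

/-- `f ∈ L^p(w^p)`: the product `w f` lies in `L^p`. -/
def MemWeightedLp {n : ℕ} (p : ℝ) (w : EuclideanSpace ℝ (Fin n) → ℝ)
    (f : EuclideanSpace ℝ (Fin n) → ℂ) : Prop :=
  MemLp (fun x => (w x : ℂ) * f x) (ENNReal.ofReal p) volume

/-- `‖w f‖_{L^p}`. -/
def weightedLpNorm {n : ℕ} (p : ℝ) (w : EuclideanSpace ℝ (Fin n) → ℝ)
    (f : EuclideanSpace ℝ (Fin n) → ℂ) : ℝ≥0∞ :=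
  eLpNorm (fun x => (w x : ℂ) * f x) (ENNReal.ofReal p) volume

/-- The weak-type bound `‖I_α f‖_{L^{q,∞}(w^q)} ≤ c [w]_{A_{p,q}}^γ ‖w f‖_{L^p}`. -/
def WeakBound {n : ℕ} (α p q γ : ℝ) (c : ℝ≥0) (w : EuclideanSpace ℝ (Fin n) → ℝ)
    (f : EuclideanSpace ℝ (Fin n) → ℂ) : Prop :=
  weakNorm q (wpow w q) (rieszPotential α f) ≤ c * apqConst p q w ^ γ * weightedLpNorm p w f

/-- The Hardy–Littlewood maximal function `Mu(x) = sup_{Q ∋ x} ⨍_Q |u|` over cubes. -/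
def maximalFunction {n : ℕ} (u : EuclideanSpace ℝ (Fin n) → ℝ)
    (x : EuclideanSpace ℝ (Fin n)) : ℝ≥0∞ :=
  ⨆ (a : EuclideanSpace ℝ (Fin n)) (l : ℝ) (_ : 0 < l ∧ x ∈ cube a l), avg (cube a l) fun y => ‖u y‖ₑ

end FractionalIntegral

end

noncomputable section

namespace FractionalIntegral

open Set Metric

/-! All upper bounds come from one duality argument. With `U = u dx`, Tonelli moves the potential
off `f`: `∫_S I_α|f| dU = ∫ |f| I_α(1_S u)`. On `S ⊆ {I_α|f| > t}` the left side is at least `t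
U(S)`, so an estimate of the right side by `A U(S)^(1-1/q)` gives the weak bound with constant `A`
(`rieszMajorant_weak_of_testing`). Since it is proved for the potential of `|f|`, it also yields
absolute convergence. The potential `I_α(1_S u)` is handled by a Hedberg inequality
(`lintegral_rieszKernel_le`): if `∫_{B(y,s) ∩ S} u ≤ M(y) s^n` for all `s`, then `I_α(1_S u)(y) ≤
(n/α) U(S)^(α/n) M(y)^(1-α/n)`. It remains to bound `∫ |f| M^(1-α/n)`.

For arbitrary `u`, `M` is a multiple of `Mu`, which is the endpoint inequality. For `p = 1`, the
`A_{1,q}` condition permits `M` to be a multiple of `[w] w^q`, whose power `1-α/n = 1/q` is of order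
`[w]^(1-α/n) w`. For `p > 1`, Hölder reduces the matter to `M(1_S w^q)` in `L^(1+σ)(w^(-p'))` with
`σ = p'/q`. Buckley's sharp bound there, `[w]^(1+σ) U(S)`, gives the exponent `(1+σ)/p' = 1-α/n`. It
is proved in `exists_density_bound` by Lerner's pointwise domination of the maximal function by two
weighted centered maximal functions, which Besicovitch's covering theorem bounds uniformly in the
measure.

For sharpness take `w^q = |x|^(δ-n)`, with constant `O(1/δ)`, and `f = |x|^(δ-α)` on the unit ball.
Then `‖wf‖_p` is `O(δ^(-1/p))`, while `I_α f` is at least of order `1/δ` on a small ball of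
`w^q`-mass of order `1/δ`. Hence the weak norm is at least of order `δ^(-1-1/q)`, and `1 + 1/q - 1/p
= 1 - α/n`. -/

/-- The centered maximal function of `g` with respect to the measure `μ`. -/
def centeredMaximal {X : Type*} [MetricSpace X] [MeasurableSpace X] (μ : Measure X)
    (g : X → ℝ≥0∞) (x : X) : ℝ≥0∞ :=
  ⨆ (r : ℝ) (_ : 0 < r), (∫⁻ y in ball x r, g y ∂μ) / μ (closedBall x r)

/-! ### Layer cake formulas. -/

/-- The layer cake formula for a constant. -/
theorem lintegral_rpow_mul_indicator_lt {p : ℝ} (hp : 0 < p) (c : ℝ≥0∞) :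
    ∫⁻ t in Ioi (0 : ℝ), ENNReal.ofReal (p * t ^ (p - 1)) *
      {t : ℝ | ENNReal.ofReal t < c}.indicator 1 t = c ^ p := by
  have key : ∀ b : ℝ, 0 ≤ b →
      ∫⁻ t in Ioo 0 b, ENNReal.ofReal (p * t ^ (p - 1)) = ENNReal.ofReal b ^ p := by
    intro b hb
    have hint : IntervalIntegrable (fun t : ℝ => p * t ^ (p - 1)) volume 0 b :=
      (intervalIntegral.intervalIntegrable_rpow' (by linarith)).const_mul p
    rw [← ofReal_integral_eq_lintegral_ofReal, ← integral_Ioc_eq_integral_Ioo,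
      ← intervalIntegral.integral_of_le hb, intervalIntegral.integral_const_mul,
      integral_rpow (Or.inl (by linarith)), ENNReal.ofReal_rpow_of_nonneg hb hp.le]
    · congr 1
      rw [sub_add_cancel, Real.zero_rpow hp.ne']
      field_simp
      ring
    · rw [intervalIntegrable_iff_integrableOn_Ioc_of_le hb] at hint
      exact hint.mono_set Ioo_subset_Ioc_self
    · filter_upwards [ae_restrict_mem measurableSet_Ioo] with t ht
      have := ht.1
      positivity
  have hpull : ∀ c : ℝ≥0∞, ∫⁻ t in Ioi (0 : ℝ), ENNReal.ofReal (p * t ^ (p - 1)) *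
      {t : ℝ | ENNReal.ofReal t < c}.indicator 1 t
      = ∫⁻ t in {t : ℝ | ENNReal.ofReal t < c} ∩ Ioi 0, ENNReal.ofReal (p * t ^ (p - 1)) := by
    intro c
    have hm : MeasurableSet {t : ℝ | ENNReal.ofReal t < c} :=
      measurableSet_lt ENNReal.measurable_ofReal measurable_const
    rw [← Measure.restrict_restrict hm, ← lintegral_indicator hm]
    congr 1 with t
    by_cases ht : t ∈ {t : ℝ | ENNReal.ofReal t < c} <;> simp [ht]
  rw [hpull]
  induction c with
  | top =>
    rw [ENNReal.top_rpow_of_pos hp, eq_top_iff]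
    refine le_of_tendsto' (x := Filter.atTop) (f := fun k : ℕ => ENNReal.ofReal (k : ℝ) ^ p)
      ?_ fun k => ?_
    · have := (ENNReal.continuous_rpow_const (y := p)).tendsto ∞
      rw [ENNReal.top_rpow_of_pos hp] at this
      refine this.comp ?_
      simpa using ENNReal.tendsto_nat_nhds_top
    · rw [← key k k.cast_nonneg]
      refine lintegral_mono_set fun t ht => ⟨by simp, ht.1⟩
  | coe c =>
    have : {t : ℝ | ENNReal.ofReal t < c} ∩ Ioi 0 = Ioo 0 (c : ℝ) := by
      ext t
      simp only [mem_inter_iff, mem_ofPred_eq, mem_Ioi, mem_Ioo]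
      rw [and_comm]
      refine and_congr_right fun h => ?_
      rw [← ENNReal.ofReal_coe_nnreal, ENNReal.ofReal_lt_ofReal_iff_of_nonneg h.le]
    rw [this]
    exact (key _ c.coe_nonneg).trans (by rw [ENNReal.ofReal_coe_nnreal])

/-- Tonelli applied to the constant case. The extra density `h` is what Marcinkiewicz interpolation
needs, where the weak bound leaves an integral of `g` over a superlevel set. -/
theorem lintegral_rpow_eq_lintegral_meas {X : Type*} [MeasurableSpace X] {μ : Measure X}
    [SFinite μ] {p : ℝ} (hp : 0 < p)
    {F h : X → ℝ≥0∞} (hF : Measurable F) (hh : Measurable h) :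
    ∫⁻ x, h x * F x ^ p ∂μ = ∫⁻ t in Ioi (0 : ℝ), ENNReal.ofReal (p * t ^ (p - 1)) *
      ∫⁻ x in {x | ENNReal.ofReal t < F x}, h x ∂μ := by
  have hset : MeasurableSet {z : X × ℝ | ENNReal.ofReal z.2 < F z.1} :=
    measurableSet_lt (ENNReal.measurable_ofReal.comp measurable_snd) (hF.comp measurable_fst)
  calc ∫⁻ x, h x * F x ^ p ∂μ
      = ∫⁻ x, (∫⁻ t in Ioi (0 : ℝ), ENNReal.ofReal (p * t ^ (p - 1)) *
          ({z : X × ℝ | ENNReal.ofReal z.2 < F z.1}.indicator 1 (x, t) * h x)) ∂μ := by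
        refine lintegral_congr fun x => ?_
        rw [← lintegral_rpow_mul_indicator_lt hp, mul_comm, ← lintegral_mul_const]
        · refine lintegral_congr fun t => ?_
          rw [mul_assoc]
          rfl
        · refine Measurable.mul (by fun_prop) ?_
          exact measurable_one.indicator
            (measurableSet_lt ENNReal.measurable_ofReal measurable_const)
    _ = ∫⁻ t in Ioi (0 : ℝ), ∫⁻ x, ENNReal.ofReal (p * t ^ (p - 1)) *
          ({z : X × ℝ | ENNReal.ofReal z.2 < F z.1}.indicator 1 (x, t) * h x) ∂μ := by
        refine lintegral_lintegral_swap (Measurable.aemeasurable ?_)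
        refine Measurable.mul (by fun_prop) (Measurable.mul ?_ (hh.comp measurable_fst))
        exact measurable_one.indicator hset
    _ = _ := by
        refine lintegral_congr fun t => ?_
        have hm : MeasurableSet {x | ENNReal.ofReal t < F x} :=
          measurableSet_lt measurable_const hF
        rw [lintegral_const_mul' _ _ ENNReal.ofReal_ne_top, ← lintegral_indicator hm]
        congr 1
        refine lintegral_congr fun x => ?_
        by_cases hx : ENNReal.ofReal t < F x <;> simp [indicator, hx]

/-! ### Centered maximal functions for arbitrary measures. -/

section Maximal

variable {X : Type*} [MetricSpace X] [MeasurableSpace X]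

theorem lintegral_ball_le_centeredMaximal_mul {μ : Measure X} {g : X → ℝ≥0∞} {x : X} {r : ℝ}
    (hr : 0 < r) (hfin : μ (closedBall x r) ≠ ∞) :
    ∫⁻ y in ball x r, g y ∂μ ≤ centeredMaximal μ g x * μ (closedBall x r) := by
  by_cases h0 : μ (closedBall x r) = 0
  · rw [Measure.restrict_eq_zero.2 (measure_mono_null ball_subset_closedBall h0)]
    simp
  · rw [← ENNReal.div_le_iff h0 hfin]
    exact le_iSup₂ (f := fun (r : ℝ) (_ : 0 < r) =>
      (∫⁻ y in ball x r, g y ∂μ) / μ (closedBall x r)) r hr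

/-- An integral over an open ball is the supremum over slightly smaller concentric balls, which
leaves room to move the center. Open balls in the numerator and closed ones in the denominator make
both inclusions go the right way. -/
theorem isOpen_lt_centeredMaximal [OpensMeasurableSpace X] (μ : Measure X) (g : X → ℝ≥0∞)
    (t : ℝ≥0∞) : IsOpen {x | t < centeredMaximal μ g x} := by
  rw [Metric.isOpen_iff]
  intro x hx
  obtain ⟨r, hr, hlt⟩ : ∃ r : ℝ, ∃ _ : 0 < r,
      t < (∫⁻ y in ball x r, g y ∂μ) / μ (closedBall x r) := by
    simpa only [centeredMaximal, mem_ofPred_eq, lt_iSup_iff] using hx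
  have hmono : Monotone fun k : ℕ => ball x (r - 1 / ((k : ℝ) + 1)) := by
    intro i j hij
    refine ball_subset_ball ?_
    have : 1 / ((j : ℝ) + 1) ≤ 1 / ((i : ℝ) + 1) := by gcongr
    linarith
  have hunion : ball x r = ⋃ k : ℕ, ball x (r - 1 / ((k : ℝ) + 1)) := by
    ext y
    simp only [mem_ball, mem_iUnion]
    constructor
    · intro hy
      obtain ⟨k, hk⟩ := exists_nat_one_div_lt (sub_pos.2 hy)
      exact ⟨k, by linarith⟩
    · rintro ⟨k, hk⟩
      have : (0 : ℝ) < 1 / ((k : ℝ) + 1) := by positivity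
      linarith
  have hsup : ∫⁻ y in ball x r, g y ∂μ
      = ⨆ k : ℕ, ∫⁻ y in ball x (r - 1 / ((k : ℝ) + 1)), g y ∂μ := by
    rw [hunion, setLIntegral_iUnion_of_directed _ (hmono.directed_le)]
  rw [hsup, ENNReal.iSup_div, lt_iSup_iff] at hlt
  obtain ⟨k, hk⟩ := hlt
  set ε : ℝ := 1 / ((k : ℝ) + 1) with hε
  have hεpos : 0 < ε := by positivity
  have hrε : 0 < r - ε := by
    by_contra hcon
    rw [ball_eq_empty.2 (not_lt.1 hcon)] at hk
    simp at hk
  refine ⟨ε / 2, by positivity, fun y hy => ?_⟩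
  rw [mem_ball] at hy
  have hb : ball x (r - ε) ⊆ ball y (r - ε / 2) :=
    ball_subset_ball' (by rw [dist_comm]; linarith)
  have hc : closedBall y (r - ε / 2) ⊆ closedBall x r :=
    closedBall_subset_closedBall' (by linarith)
  refine hk.trans_le ?_
  calc (∫⁻ z in ball x (r - ε), g z ∂μ) / μ (closedBall x r)
      ≤ (∫⁻ z in ball y (r - ε / 2), g z ∂μ) / μ (closedBall y (r - ε / 2)) :=
        ENNReal.div_le_div (lintegral_mono_set hb) (measure_mono hc)
    _ ≤ centeredMaximal μ g y :=
        le_iSup₂ (f := fun (r : ℝ) (_ : 0 < r) =>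
          (∫⁻ z in ball y r, g z ∂μ) / μ (closedBall y r)) (r - ε / 2) (by linarith)

theorem measurable_centeredMaximal [OpensMeasurableSpace X] (μ : Measure X) (g : X → ℝ≥0∞) :
    Measurable (centeredMaximal μ g) :=
  measurable_of_Ioi fun t => (isOpen_lt_centeredMaximal μ g t).measurableSet

variable (X) in
/-- The centered maximal function is of weak type `(1, 1)`, uniformly in the measure. -/
theorem exists_centeredMaximal_weak [SecondCountableTopology X] [OpensMeasurableSpace X]
    [HasBesicovitchCovering X] :
    ∃ N : ℕ, ∀ (μ : Measure X) (g : X → ℝ≥0∞) (t : ℝ≥0∞),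
      t * μ {x | t < centeredMaximal μ g x} ≤ N * ∫⁻ y, g y ∂μ := by
  obtain ⟨N, τ, hτ, hN⟩ :=
    HasBesicovitchCovering.no_satelliteConfig (α := X)
  refine ⟨N, fun μ g t => ?_⟩
  let A : ℕ → Set X := fun k => {x | ∃ r : ℝ, 0 < r ∧ r ≤ k ∧
    t < (∫⁻ y in ball x r, g y ∂μ) / μ (closedBall x r)}
  have hA : {x | t < centeredMaximal μ g x} = ⋃ k, A k := by
    ext x
    simp only [centeredMaximal, mem_ofPred_eq, lt_iSup_iff, mem_iUnion, A]
    constructor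
    · rintro ⟨r, hr, h⟩
      obtain ⟨k, hk⟩ := exists_nat_ge r
      exact ⟨k, r, hr, hk, h⟩
    · rintro ⟨k, r, hr, -, h⟩
      exact ⟨r, hr, h⟩
  have hAmono : Monotone A := by
    rintro i j hij x ⟨r, hr, hri, h⟩
    exact ⟨r, hr, hri.trans (by exact_mod_cast hij), h⟩
  rw [hA, hAmono.measure_iUnion, ENNReal.mul_iSup]
  refine iSup_le fun k => ?_
  choose! ρ hρ0 hρk hρ using fun (x : X) (hx : x ∈ A k) => hx
  let P : Besicovitch.BallPackage (A k) X :=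
    { c := fun x => x
      r := fun x => ρ x
      rpos := fun x => hρ0 x x.2
      r_bound := k
      r_le := fun x => hρk x x.2 }
  obtain ⟨s, hdisj, hcov⟩ := Besicovitch.exist_disjoint_covering_families hτ hN P
  have hcount : ∀ i, (s i).Countable := by
    intro i
    refine Set.PairwiseDisjoint.countable_of_isOpen (s := fun j : A k => ball (j : X) (ρ j))
      (fun a ha b hb hab => ?_) (fun _ _ => isOpen_ball)
      (fun j _ => nonempty_ball.2 (hρ0 j j.2))
    exact (hdisj i ha hb hab).mono ball_subset_closedBall ball_subset_closedBall
  have hsub : A k ⊆ ⋃ i : Fin N, ⋃ j ∈ s i, closedBall (j : X) (ρ j) := by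
    intro x hx
    have := hcov ⟨⟨x, hx⟩, rfl⟩
    simp only [mem_iUnion] at this ⊢
    obtain ⟨i, j, hj, hxj⟩ := this
    exact ⟨i, j, hj, ball_subset_closedBall hxj⟩
  have hfam : ∀ i, t * μ (⋃ j ∈ s i, closedBall (j : X) (ρ j)) ≤ ∫⁻ y, g y ∂μ := by
    intro i
    have := (hcount i).to_subtype
    calc t * μ (⋃ j ∈ s i, closedBall (j : X) (ρ j))
        ≤ t * ∑' j : s i, μ (closedBall ((j : A k) : X) (ρ (j : A k))) := by
          gcongr
          exact measure_biUnion_le μ (hcount i) _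
      _ = ∑' j : s i, t * μ (closedBall ((j : A k) : X) (ρ (j : A k))) := ENNReal.tsum_mul_left.symm
      _ ≤ ∑' j : s i, ∫⁻ y in ball ((j : A k) : X) (ρ (j : A k)), g y ∂μ :=
          ENNReal.tsum_le_tsum fun j => ENNReal.mul_le_of_le_div (hρ _ (j : A k).2).le
      _ = ∫⁻ y in ⋃ j ∈ s i, ball (j : X) (ρ j), g y ∂μ := by
          rw [lintegral_biUnion (hcount i) (fun _ _ => isOpen_ball.measurableSet)]
          intro a ha b hb hab
          exact (hdisj i ha hb hab).mono ball_subset_closedBall ball_subset_closedBall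
      _ ≤ ∫⁻ y, g y ∂μ := setLIntegral_le_lintegral _ _
  calc t * μ (A k) ≤ t * ∑ i : Fin N, μ (⋃ j ∈ s i, closedBall (j : X) (ρ j)) := by
        gcongr
        refine (measure_mono hsub).trans ?_
        exact (measure_iUnion_le _).trans_eq (tsum_fintype _)
    _ = ∑ i : Fin N, t * μ (⋃ j ∈ s i, closedBall (j : X) (ρ j)) := Finset.mul_sum _ _ _
    _ ≤ ∑ _i : Fin N, ∫⁻ y, g y ∂μ := Finset.sum_le_sum fun i _ => hfam i
    _ = N * ∫⁻ y, g y ∂μ := by simp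

/-- Marcinkiewicz truncation: the part of `g` that is at most `t / 2` contributes at most `t / 2` to
any average. -/
theorem setOf_lt_centeredMaximal_subset (μ : Measure X) {g : X → ℝ≥0∞} (hg : Measurable g)
    (t : ℝ≥0) :
    {x | (t : ℝ≥0∞) < centeredMaximal μ g x} ⊆
      {x | (t : ℝ≥0∞) / 2 < centeredMaximal μ ({y | (t : ℝ≥0∞) < 2 * g y}.indicator g) x} := by
  intro x hx
  have hm : MeasurableSet {y | (t : ℝ≥0∞) < 2 * g y} :=
    measurableSet_lt measurable_const (hg.const_mul 2)
  by_contra hcon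
  simp only [mem_ofPred_eq, not_lt] at hcon
  refine (not_lt.2 ?_) (show (t : ℝ≥0∞) < centeredMaximal μ g x from hx)
  refine iSup₂_le fun r hr => ?_
  have hle : ∀ y, g y ≤ {y | (t : ℝ≥0∞) < 2 * g y}.indicator g y + t / 2 := by
    intro y
    by_cases hy : (t : ℝ≥0∞) < 2 * g y
    · simp [indicator, hy]
    · simp only [indicator, mem_ofPred_eq, hy, if_false, zero_add]
      rw [ENNReal.le_div_iff_mul_le (by simp) (by simp), mul_comm]
      exact not_lt.1 hy
  calc (∫⁻ y in ball x r, g y ∂μ) / μ (closedBall x r)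
      ≤ (∫⁻ y in ball x r, ({y | (t : ℝ≥0∞) < 2 * g y}.indicator g y + t / 2) ∂μ)
          / μ (closedBall x r) := ENNReal.div_le_div_right (lintegral_mono hle) _
    _ = (∫⁻ y in ball x r, {y | (t : ℝ≥0∞) < 2 * g y}.indicator g y ∂μ) / μ (closedBall x r)
          + (t / 2 * μ (ball x r)) / μ (closedBall x r) := by
        rw [lintegral_add_right _ measurable_const, ENNReal.add_div]
        simp
    _ ≤ t / 2 + t / 2 := by
        refine add_le_add ?_ ?_
        · exact (le_iSup₂ (f := fun (r : ℝ) (_ : 0 < r) =>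
            (∫⁻ y in ball x r, {y | (t : ℝ≥0∞) < 2 * g y}.indicator g y ∂μ)
              / μ (closedBall x r)) r hr).trans hcon
        · refine ENNReal.div_le_of_le_mul ?_
          gcongr
          exact ball_subset_closedBall
    _ = t := ENNReal.add_halves _

variable (X) in
/-- The centered maximal function is of strong type `(p, p)`, uniformly in the measure. -/
theorem exists_centeredMaximal_strong [SecondCountableTopology X] [OpensMeasurableSpace X]
    [HasBesicovitchCovering X] {p : ℝ} (hp : 1 < p) :
    ∃ C : ℝ≥0, ∀ (μ : Measure X) [SFinite μ] (g : X → ℝ≥0∞), Measurable g →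
      ∫⁻ x, centeredMaximal μ g x ^ p ∂μ ≤ C * ∫⁻ y, g y ^ p ∂μ := by
  obtain ⟨N, hN⟩ := exists_centeredMaximal_weak X
  refine ⟨2 * N * (p / (p - 1)).toNNReal * 2 ^ (p - 1), fun μ _ g hg => ?_⟩
  have hp0 : 0 < p := by linarith
  have hp1 : 0 < p - 1 := by linarith
  have hstep : ∀ t ∈ Ioi (0 : ℝ), ENNReal.ofReal (p * t ^ (p - 1)) *
      μ {x | ENNReal.ofReal t < centeredMaximal μ g x} ≤
      (2 * N * ENNReal.ofReal (p / (p - 1))) * (ENNReal.ofReal ((p - 1) * t ^ (p - 1 - 1)) *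
        ∫⁻ x in {x | ENNReal.ofReal t < 2 * g x}, g x ∂μ) := by
    intro t ht
    have ht : 0 < t := ht
    have hm : MeasurableSet {y | ENNReal.ofReal t < 2 * g y} :=
      measurableSet_lt measurable_const (hg.const_mul 2)
    have h1 : ENNReal.ofReal t / 2 * μ {x | ENNReal.ofReal t < centeredMaximal μ g x} ≤
        N * ∫⁻ x in {x | ENNReal.ofReal t < 2 * g x}, g x ∂μ := by
      rw [← lintegral_indicator hm]
      refine le_trans (mul_le_mul_right (measure_mono ?_) _) (hN μ _ (ENNReal.ofReal t / 2))
      exact setOf_lt_centeredMaximal_subset μ hg t.toNNReal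
    have h2 : ENNReal.ofReal t * μ {x | ENNReal.ofReal t < centeredMaximal μ g x} ≤
        2 * N * ∫⁻ x in {x | ENNReal.ofReal t < 2 * g x}, g x ∂μ := by
      calc _ = 2 * (ENNReal.ofReal t / 2 * μ {x | ENNReal.ofReal t < centeredMaximal μ g x}) := by
            rw [← mul_assoc, ENNReal.mul_div_cancel (by simp) (by simp)]
        _ ≤ _ := by
            rw [mul_assoc]
            gcongr
    -- The factor `t` is absorbed by the weak bound; what remains is the layer cake density for the
    -- exponent `p - 1`.
    have h3 : p * t ^ (p - 1) = (p / (p - 1)) * ((p - 1) * t ^ (p - 1 - 1)) * t := by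
      rw [Real.rpow_sub_one ht.ne' (p - 1)]
      field_simp
    rw [h3, ENNReal.ofReal_mul (by positivity), ENNReal.ofReal_mul (by positivity), mul_assoc]
    calc _ ≤ ENNReal.ofReal (p / (p - 1)) * ENNReal.ofReal ((p - 1) * t ^ (p - 1 - 1)) *
          (2 * N * ∫⁻ x in {x | ENNReal.ofReal t < 2 * g x}, g x ∂μ) := by gcongr
      _ = _ := by ring
  calc ∫⁻ x, centeredMaximal μ g x ^ p ∂μ
      = ∫⁻ t in Ioi (0 : ℝ), ENNReal.ofReal (p * t ^ (p - 1)) *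
          μ {x | ENNReal.ofReal t < centeredMaximal μ g x} := by
        simpa using lintegral_rpow_eq_lintegral_meas (μ := μ) hp0
          (measurable_centeredMaximal μ g) measurable_one
    _ ≤ ∫⁻ t in Ioi (0 : ℝ), (2 * N * ENNReal.ofReal (p / (p - 1))) *
          (ENNReal.ofReal ((p - 1) * t ^ (p - 1 - 1)) *
            ∫⁻ x in {x | ENNReal.ofReal t < 2 * g x}, g x ∂μ) :=
        setLIntegral_mono' measurableSet_Ioi hstep
    _ = (2 * N * ENNReal.ofReal (p / (p - 1))) * ∫⁻ x, g x * (2 * g x) ^ (p - 1) ∂μ := by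
        rw [lintegral_const_mul' _ _ (by finiteness),
          lintegral_rpow_eq_lintegral_meas hp1 (hg.const_mul 2) hg]
    _ = (2 * N * ENNReal.ofReal (p / (p - 1))) * (2 ^ (p - 1) * ∫⁻ x, g x ^ p ∂μ) := by
        rw [← lintegral_const_mul' (2 ^ (p - 1)) _ (by finiteness)]
        congr 1
        refine lintegral_congr fun x => ?_
        rw [ENNReal.mul_rpow_of_nonneg _ _ hp1.le, mul_left_comm]
        congr 1
        nth_rewrite 1 [← ENNReal.rpow_one (g x)]
        rw [← ENNReal.rpow_add_of_nonneg _ _ zero_le_one hp1.le, add_sub_cancel]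
    _ = _ := by
        rw [← mul_assoc]
        congr 1
        push_cast
        rw [ENNReal.coe_rpow_of_nonneg _ hp1.le]
        rfl

end Maximal

/-! ### The Riesz potential: Hedberg's inequality and testing by duality. -/

section Potential

variable {n : ℕ} {α : ℝ}

/-- The Riesz kernel `|x - y|^(α - n)`, with the value `0` on the diagonal. -/
def rieszKernel (α : ℝ) (x y : EuclideanSpace ℝ (Fin n)) : ℝ≥0∞ :=
  ENNReal.ofReal (‖x - y‖ ^ ((n : ℝ) - α))⁻¹

/-- The Riesz potential of `|f|`, with values in `[0, ∞]`. -/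
def rieszMajorant (α : ℝ) (f : EuclideanSpace ℝ (Fin n) → ℂ) (x : EuclideanSpace ℝ (Fin n)) :
    ℝ≥0∞ :=
  ∫⁻ y, ‖f y‖ₑ * rieszKernel α x y

theorem measurable_rieszKernel :
    Measurable fun z : EuclideanSpace ℝ (Fin n) × EuclideanSpace ℝ (Fin n) =>
      rieszKernel α z.1 z.2 := by
  unfold rieszKernel
  fun_prop

theorem enorm_div_eq_mul_rieszKernel (f : EuclideanSpace ℝ (Fin n) → ℂ)
    (x y : EuclideanSpace ℝ (Fin n)) :
    ‖f y / ((‖x - y‖ ^ ((n : ℝ) - α) : ℝ) : ℂ)‖ₑ = ‖f y‖ₑ * rieszKernel α x y := by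
  rw [div_eq_mul_inv, enorm_mul, ← Complex.ofReal_inv, rieszKernel]
  congr 1
  rw [← ofReal_norm, Complex.norm_real, Real.norm_of_nonneg (by positivity)]

theorem enorm_rieszPotential_le (f : EuclideanSpace ℝ (Fin n) → ℂ)
    (x : EuclideanSpace ℝ (Fin n)) : ‖rieszPotential α f x‖ₑ ≤ rieszMajorant α f x := by
  refine (enorm_integral_le_lintegral_enorm _).trans_eq ?_
  simp_rw [enorm_div_eq_mul_rieszKernel]
  rfl

theorem rieszConverges_iff {f : EuclideanSpace ℝ (Fin n) → ℂ}
    (hf : AEStronglyMeasurable f volume) (x : EuclideanSpace ℝ (Fin n)) :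
    RieszConverges α f x ↔ rieszMajorant α f x < ∞ := by
  have hm : AEStronglyMeasurable (fun y => f y / ((‖x - y‖ ^ ((n : ℝ) - α) : ℝ) : ℂ)) volume := by
    refine (hf.aemeasurable.div (Measurable.aemeasurable ?_)).aestronglyMeasurable
    fun_prop
  rw [RieszConverges, Integrable, and_iff_right hm, HasFiniteIntegral]
  simp_rw [enorm_div_eq_mul_rieszKernel]
  rfl

theorem measurable_rieszMajorant {f : EuclideanSpace ℝ (Fin n) → ℂ}
    (hf : AEStronglyMeasurable f volume) : Measurable (rieszMajorant α f) := by
  have heq : rieszMajorant α f = rieszMajorant α (hf.mk f) := by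
    ext x
    refine lintegral_congr_ae ?_
    filter_upwards [hf.ae_eq_mk] with y hy
    rw [hy]
  rw [heq]
  refine Measurable.lintegral_prod_right' (f := fun z : EuclideanSpace ℝ (Fin n) ×
    EuclideanSpace ℝ (Fin n) => ‖hf.mk f z.2‖ₑ * rieszKernel α z.1 z.2) ?_
  exact ((hf.stronglyMeasurable_mk.measurable.comp measurable_snd).enorm).mul
    measurable_rieszKernel

theorem setOf_lt_rieszKernel_subset (hαn : α < n) (y : EuclideanSpace ℝ (Fin n)) {t : ℝ}
    (ht : 0 < t) :
    {x | t < (‖x - y‖ ^ ((n : ℝ) - α))⁻¹} ⊆ ball y ((t⁻¹) ^ ((n : ℝ) - α)⁻¹) := by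
  intro x hx
  have hx : t < (‖x - y‖ ^ ((n : ℝ) - α))⁻¹ := hx
  have hd : 0 < (n : ℝ) - α := sub_pos.2 hαn
  rw [mem_ball, dist_eq_norm, Real.lt_rpow_inv_iff_of_pos (norm_nonneg _) (by positivity) hd]
  have hpos : 0 < ‖x - y‖ ^ ((n : ℝ) - α) := inv_pos.1 (ht.trans hx)
  exact (lt_inv_comm₀ ht hpos).1 hx

/-- A Hedberg type bound: the potential of a finite measure is controlled by its mass and by its
densities on balls. -/
theorem lintegral_rieszKernel_le (hα : 0 < α) (hαn : α < n)
    (μ : Measure (EuclideanSpace ℝ (Fin n))) (hfin : μ univ ≠ ∞) (y : EuclideanSpace ℝ (Fin n))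
    (M : ℝ≥0∞) (hM : ∀ s : ℝ, 0 < s → μ (ball y s) ≤ M * ENNReal.ofReal s ^ n) :
    ∫⁻ x, rieszKernel α x y ∂μ ≤
      ENNReal.ofReal (n / α) * (μ univ ^ (α / n) * M ^ (1 - α / n)) := by
  have hn : (0 : ℝ) < n := hα.trans hαn
  have hd : 0 < (n : ℝ) - α := sub_pos.2 hαn
  have hθ : 0 < α / n := by positivity
  have hθ1 : α / n < 1 := (div_lt_one hn).2 hαn
  -- Superlevel sets of the kernel lie in balls of radius `t^(-1/(n-α))`, whose `n`-th power is
  -- `t^(-1/(1-α/n))`.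
  have hlevel : ∀ t ∈ Ioi (0 : ℝ), μ {x | t < (‖x - y‖ ^ ((n : ℝ) - α))⁻¹} ≤
      min (μ univ) (M * ENNReal.ofReal (t ^ (-(1 - α / n)⁻¹))) := by
    intro t ht
    have ht : 0 < t := ht
    refine le_min (measure_mono (subset_univ _)) ?_
    refine (measure_mono (setOf_lt_rieszKernel_subset hαn y ht)).trans ?_
    refine (hM _ (by positivity)).trans_eq ?_
    rw [← ENNReal.ofReal_pow (by positivity), ← Real.rpow_natCast, ← Real.rpow_mul (by positivity),
      Real.inv_rpow ht.le, ← Real.rpow_neg ht.le]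
    congr 4
    field_simp
  have hlc : ∫⁻ x, rieszKernel α x y ∂μ
      = ∫⁻ t in Ioi (0 : ℝ), μ {x | t < (‖x - y‖ ^ ((n : ℝ) - α))⁻¹} := by
    refine lintegral_eq_lintegral_meas_lt μ (Filter.Eventually.of_forall fun x => ?_) ?_
    · exact inv_nonneg.2 (by positivity)
    · exact Measurable.aemeasurable (by fun_prop)
  rcases eq_or_ne (μ univ) 0 with h0 | h0
  · rw [Measure.measure_univ_eq_zero.1 h0]
    simp
  rcases eq_or_ne M ∞ with hMt | hMt
  · rw [hMt, ENNReal.top_rpow_of_pos (by linarith), ENNReal.mul_top, ENNReal.mul_top]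
    · exact le_top
    · simpa using by positivity
    · simp [h0, hθ.not_gt, hfin]
  rcases eq_or_ne M 0 with hM0 | hM0
  · rw [hlc]
    have : ∫⁻ t in Ioi (0 : ℝ), μ {x | t < (‖x - y‖ ^ ((n : ℝ) - α))⁻¹} ≤
        ∫⁻ _t in Ioi (0 : ℝ), 0 := by
      refine setLIntegral_mono' measurableSet_Ioi fun t ht => ?_
      refine (hlevel t ht).trans ?_
      simp [hM0]
    refine this.trans ?_
    simp
  obtain ⟨m, hm⟩ : ∃ m : ℝ, M.toReal = m := ⟨_, rfl⟩
  obtain ⟨u, hu⟩ : ∃ u : ℝ, (μ univ).toReal = u := ⟨_, rfl⟩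
  have hmpos : 0 < m := hm ▸ ENNReal.toReal_pos hM0 hMt
  have hupos : 0 < u := hu ▸ ENNReal.toReal_pos h0 hfin
  have hMm : M = ENNReal.ofReal m := by rw [← hm, ENNReal.ofReal_toReal hMt]
  have hUu : μ univ = ENNReal.ofReal u := by rw [← hu, ENNReal.ofReal_toReal hfin]
  rw [hUu, hMm] at hlevel
  rw [hlc, hUu, hMm]
  generalize hθdef : α / (n : ℝ) = θ at *
  have hr : -(1 - θ)⁻¹ < -1 := by
    have h1 : 1 < (1 - θ)⁻¹ := (one_lt_inv₀ (by linarith)).2 (by linarith)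
    linarith
  -- The height at which the two bounds for the level sets coincide. The two pieces add up to `1 +
  -- (1-θ)/θ = n/α` times `u^θ m^(1-θ)`.
  set τ : ℝ := (m / u) ^ (1 - θ) with hτ
  have hτpos : 0 < τ := by positivity
  have e1 : u * τ = u ^ θ * m ^ (1 - θ) := by
    rw [hτ, Real.div_rpow hmpos.le hupos.le, Real.rpow_sub hupos, Real.rpow_one]
    field_simp
  have hτ2 : τ ^ (-(1 - θ)⁻¹ + 1) = u ^ θ * m ^ (-θ) := by
    rw [hτ, ← Real.rpow_mul (by positivity)]
    have : (1 - θ) * (-(1 - θ)⁻¹ + 1) = -θ := by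
      have : 1 - θ ≠ 0 := by linarith
      field_simp
      ring
    rw [this, Real.div_rpow hmpos.le hupos.le, Real.rpow_neg hupos.le, div_inv_eq_mul, mul_comm]
  have e2 : m * ∫ t in Ioi τ, t ^ (-(1 - θ)⁻¹) = (1 - θ) / θ * (u ^ θ * m ^ (1 - θ)) := by
    rw [integral_Ioi_rpow_of_lt hr hτpos, hτ2, Real.rpow_neg hmpos.le, Real.rpow_sub hmpos,
      Real.rpow_one]
    have h1 : 1 - θ ≠ 0 := by linarith
    have h2 : -(1 - θ)⁻¹ + 1 = - (θ / (1 - θ)) := by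
      field_simp
      ring
    rw [h2]
    field_simp
  calc ∫⁻ t in Ioi (0 : ℝ), μ {x | t < (‖x - y‖ ^ ((n : ℝ) - α))⁻¹}
      ≤ (∫⁻ t in Ioc 0 τ, μ {x | t < (‖x - y‖ ^ ((n : ℝ) - α))⁻¹}) +
        ∫⁻ t in Ioi τ, μ {x | t < (‖x - y‖ ^ ((n : ℝ) - α))⁻¹} := by
        rw [← Ioc_union_Ioi_eq_Ioi hτpos.le]
        exact lintegral_union_le _ _ _
    _ ≤ (∫⁻ _t in Ioc 0 τ, ENNReal.ofReal u) +
        ∫⁻ t in Ioi τ, ENNReal.ofReal m * ENNReal.ofReal (t ^ (-(1 - θ)⁻¹)) := by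
        refine add_le_add (setLIntegral_mono' measurableSet_Ioc fun t ht => ?_)
          (setLIntegral_mono' measurableSet_Ioi fun t ht => ?_)
        · exact (hlevel t ht.1).trans (min_le_left _ _)
        · exact (hlevel t (hτpos.trans ht)).trans (min_le_right _ _)
    _ = ENNReal.ofReal (u * τ + m * ∫ t in Ioi τ, t ^ (-(1 - θ)⁻¹)) := by
        rw [lintegral_const_mul' _ _ ENNReal.ofReal_ne_top,
          ← ofReal_integral_eq_lintegral_ofReal (integrableOn_Ioi_rpow_of_lt hr hτpos),
          ENNReal.ofReal_add (by positivity), ENNReal.ofReal_mul hmpos.le,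
          ENNReal.ofReal_mul hupos.le]
        · simp
        · rw [e2]
          have : 0 < 1 - θ := by linarith
          positivity
        · filter_upwards [ae_restrict_mem measurableSet_Ioi] with t ht
          exact Real.rpow_nonneg (hτpos.trans ht).le _
    _ = ENNReal.ofReal (n / α) *
          (ENNReal.ofReal u ^ θ * ENNReal.ofReal m ^ (1 - θ)) := by
        rw [e1, e2, ENNReal.ofReal_rpow_of_pos hupos, ENNReal.ofReal_rpow_of_pos hmpos,
          ← ENNReal.ofReal_mul (by positivity), ← ENNReal.ofReal_mul (by positivity)]
        congr 1
        have h1 : 1 - θ ≠ 0 := by linarith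
        rw [← inv_div α (n : ℝ), hθdef]
        field_simp
        ring

/-- A weak type bound follows from testing the adjoint potential on sets of finite measure. -/
theorem rieszMajorant_weak_of_testing (U : Measure (EuclideanSpace ℝ (Fin n))) [SFinite U]
    (hloc : ∀ R : ℝ, U (ball 0 R) ≠ ∞) {f : EuclideanSpace ℝ (Fin n) → ℂ}
    (hf : AEStronglyMeasurable f volume) {A : ℝ≥0∞} {q : ℝ} (hq : 0 < q)
    (h : ∀ S, MeasurableSet S → U S ≠ ∞ →
      ∫⁻ y, ‖f y‖ₑ * ∫⁻ x in S, rieszKernel α x y ∂U ≤ A * U S ^ (1 - 1 / q)) (t : ℝ≥0) :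
    t * U {x | t < rieszMajorant α f x} ^ (1 / q) ≤ A := by
  have hmeas := measurable_rieszMajorant (α := α) hf
  have hT : MeasurableSet {x | t < rieszMajorant α f x} :=
    measurableSet_lt measurable_const hmeas
  have hq' : 0 < 1 / q := by positivity
  -- The estimate is divided by `U S ^ (1 - 1 / q)`, so it is proved for subsets of finite measure
  -- and extended by intersecting with growing balls.
  have key : ∀ S ⊆ {x | t < rieszMajorant α f x}, MeasurableSet S → U S ≠ ∞ →
      t * U S ^ (1 / q) ≤ A := by
    intro S hS hSm hSfin
    rcases eq_or_ne (U S) 0 with h0 | h0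
    · rw [h0, ENNReal.zero_rpow_of_pos hq', mul_zero]
      exact zero_le
    have h1 : t * U S ≤ A * U S ^ (1 - 1 / q) := by
      calc t * U S = ∫⁻ _x in S, t ∂U := by simp
        _ ≤ ∫⁻ x in S, rieszMajorant α f x ∂U :=
            setLIntegral_mono' hSm fun x hx => (show (t : ℝ≥0∞) < _ from hS hx).le
        _ = ∫⁻ y, ∫⁻ x in S, ‖f y‖ₑ * rieszKernel α x y ∂U := by
            refine lintegral_lintegral_swap ?_
            exact (hf.aemeasurable.enorm.comp_snd).mul measurable_rieszKernel.aemeasurable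
        _ = ∫⁻ y, ‖f y‖ₑ * ∫⁻ x in S, rieszKernel α x y ∂U := by
            refine lintegral_congr fun y => lintegral_const_mul' _ _ (by simp)
        _ ≤ _ := h S hSm hSfin
    have hsplit : U S = U S ^ (1 / q) * U S ^ (1 - 1 / q) := by
      rw [← ENNReal.rpow_add _ _ h0 hSfin, add_sub_cancel, ENNReal.rpow_one]
    have hc0 : U S ^ (1 - 1 / q) ≠ 0 := by simp [h0, hSfin]
    have hct : U S ^ (1 - 1 / q) ≠ ∞ := by simp [h0, hSfin]
    nth_rewrite 1 [hsplit] at h1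
    rw [← mul_assoc] at h1
    exact (ENNReal.mul_le_mul_iff_left hc0 hct).1 h1
  have hun : {x | t < rieszMajorant α f x} =
      ⋃ k : ℕ, {x | t < rieszMajorant α f x} ∩ ball 0 (k : ℝ) := by
    rw [← inter_iUnion, iUnion_ball_nat, inter_univ]
  have hmono : Monotone fun k : ℕ =>
      {x | t < rieszMajorant α f x} ∩ ball (0 : EuclideanSpace ℝ (Fin n)) (k : ℝ) := by
    intro i j hij
    exact inter_subset_inter_right _ (ball_subset_ball (by exact_mod_cast hij))
  have hlim := tendsto_measure_iUnion_atTop (μ := U) hmono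
  rw [← hun] at hlim
  refine le_of_tendsto' (ENNReal.Tendsto.const_mul
    ((ENNReal.continuous_rpow_const (y := 1 / q)).tendsto _ |>.comp hlim)
    (Or.inr ENNReal.coe_ne_top)) fun k => ?_
  refine key _ inter_subset_left (hT.inter measurableSet_ball) ?_
  exact measure_ne_top_of_subset inter_subset_right (hloc k)

/-- The testing condition yields both the a.e. convergence and the weak type bound. -/
theorem weakNorm_le_of_testing {u : EuclideanSpace ℝ (Fin n) → ℝ≥0∞}
    (hloc : ∀ R : ℝ, volume.withDensity u (ball 0 R) ≠ ∞) {f : EuclideanSpace ℝ (Fin n) → ℂ}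
    (hf : AEStronglyMeasurable f volume) {A : ℝ≥0∞} (hA : A ≠ ∞) {q : ℝ} (hq : 0 < q)
    (h : ∀ S, MeasurableSet S → volume.withDensity u S ≠ ∞ →
      ∫⁻ y, ‖f y‖ₑ * ∫⁻ x in S, rieszKernel α x y ∂volume.withDensity u ≤
        A * volume.withDensity u S ^ (1 - 1 / q)) :
    (∀ᵐ x ∂volume.withDensity u, RieszConverges α f x) ∧
      weakNorm q u (rieszPotential α f) ≤ A := by
  have hq' : 0 < 1 / q := by positivity
  have hw := rieszMajorant_weak_of_testing (volume.withDensity u) hloc hf hq h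
  constructor
  · simp_rw [rieszConverges_iff hf]
    rw [ae_iff]
    simp_rw [not_lt, top_le_iff]
    set z := volume.withDensity u {x | rieszMajorant α f x = ∞} with hz
    -- The set where the majorant is infinite lies in every superlevel set, so `k z^(1/q) ≤ A` for
    -- every `k`, which forces `z = 0`.
    by_contra hz0
    have hz1 : z ^ (1 / q) ≠ 0 := by simp [hz0, hq.le]
    obtain ⟨k, hk⟩ := ENNReal.exists_nat_gt (ENNReal.div_lt_top hA hz1).ne
    refine (not_le.2 hk) ?_
    rw [ENNReal.le_div_iff_mul_le (Or.inl hz1) (Or.inr hA)]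
    refine le_trans ?_ (hw k)
    push_cast
    refine mul_le_mul_right (ENNReal.rpow_le_rpow (measure_mono fun x hx => ?_) hq'.le) _
    have hx : rieszMajorant α f x = ∞ := hx
    simp [hx]
  · refine iSup_le fun t => le_trans ?_ (hw t)
    refine mul_le_mul_right (ENNReal.rpow_le_rpow (measure_mono fun x hx => ?_) hq'.le) _
    refine lt_of_lt_of_le ?_ (enorm_rieszPotential_le f x)
    rw [enorm_eq_nnnorm]
    exact_mod_cast (show t < ‖rieszPotential α f x‖₊ from hx)

end Potential

/-! ### Cubes and balls. -/

section Cubes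

variable {n : ℕ}

theorem cube_eq_preimage (a : EuclideanSpace ℝ (Fin n)) (l : ℝ) :
    cube a l = WithLp.ofLp ⁻¹' Icc (a.ofLp) (fun i => a i + l) := by
  ext x
  simp only [cube, mem_preimage, mem_ofPred_eq, mem_Icc, Pi.le_def]
  exact forall_and

theorem measurableSet_cube (a : EuclideanSpace ℝ (Fin n)) (l : ℝ) : MeasurableSet (cube a l) := by
  rw [cube_eq_preimage]
  exact (PiLp.volume_preserving_ofLp (Fin n)).measurable measurableSet_Icc

theorem volume_cube (a : EuclideanSpace ℝ (Fin n)) (l : ℝ) :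
    volume (cube a l) = ENNReal.ofReal l ^ n := by
  rw [cube_eq_preimage, (PiLp.volume_preserving_ofLp (Fin n)).measure_preimage
    measurableSet_Icc.nullMeasurableSet, Real.volume_Icc_pi]
  simp

theorem abs_sub_apply_le_dist (x y : EuclideanSpace ℝ (Fin n)) (i : Fin n) :
    |x i - y i| ≤ dist x y := by
  rw [dist_eq_norm]
  exact PiLp.norm_apply_le (x - y) i

/-- The point `x - s (1, …, 1)`. -/
def cornerShift (x : EuclideanSpace ℝ (Fin n)) (s : ℝ) : EuclideanSpace ℝ (Fin n) :=
  WithLp.toLp 2 fun i => x i - s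

theorem closedBall_subset_cube (x : EuclideanSpace ℝ (Fin n)) (s : ℝ) :
    closedBall x s ⊆ cube (cornerShift x s) (2 * s) := by
  intro y hy i
  have h := abs_le.1 ((abs_sub_apply_le_dist y x i).trans hy)
  change x i - s ≤ y i ∧ y i ≤ x i - s + 2 * s
  constructor <;> linarith [h.1, h.2]

end Cubes

/-! ### Averages over cubes. -/

section Averages

variable {n : ℕ}

theorem lintegral_cube_eq (a : EuclideanSpace ℝ (Fin n)) {l : ℝ} (hl : 0 < l)
    (g : EuclideanSpace ℝ (Fin n) → ℝ≥0∞) :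
    ∫⁻ x in cube a l, g x = ENNReal.ofReal l ^ n * avg (cube a l) g := by
  have h0 : ENNReal.ofReal l ^ n ≠ 0 := pow_ne_zero _ (by simpa using hl)
  have ht : ENNReal.ofReal l ^ n ≠ ∞ := by finiteness
  rw [avg, volume_cube, ← mul_assoc, ENNReal.mul_inv_cancel h0 ht, one_mul]

theorem avg_congr {Q : Set (EuclideanSpace ℝ (Fin n))} {g h : EuclideanSpace ℝ (Fin n) → ℝ≥0∞}
    (hgh : g =ᵐ[volume] h) : avg Q g = avg Q h := by
  rw [avg, avg, lintegral_congr_ae (ae_restrict_of_ae hgh)]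

theorem avg_one (a : EuclideanSpace ℝ (Fin n)) {l : ℝ} (hl : 0 < l) :
    avg (cube a l) 1 = 1 := by
  have h0 : ENNReal.ofReal l ^ n ≠ 0 := pow_ne_zero _ (by simpa using hl)
  have ht : ENNReal.ofReal l ^ n ≠ ∞ := by finiteness
  simp [avg, volume_cube, ENNReal.inv_mul_cancel h0 ht]

theorem avg_ne_zero (a : EuclideanSpace ℝ (Fin n)) {l : ℝ} (hl : 0 < l)
    {g : EuclideanSpace ℝ (Fin n) → ℝ≥0∞} (hg : Measurable g) (hpos : ∀ x, g x ≠ 0) :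
    avg (cube a l) g ≠ 0 := by
  rw [avg, volume_cube]
  refine mul_ne_zero (by simp) fun h => ?_
  rw [lintegral_eq_zero_iff hg] at h
  have : (volume.restrict (cube a l)) univ = 0 :=
    measure_mono_null (fun x _ => hpos x) h
  rw [Measure.restrict_apply_univ, volume_cube] at this
  exact pow_ne_zero _ (by simpa using hl) this

theorem essInf_cube_ne_top (a : EuclideanSpace ℝ (Fin n)) {l : ℝ} (hl : 0 < l)
    {g : EuclideanSpace ℝ (Fin n) → ℝ≥0∞} (hfin : ∀ x, g x ≠ ∞) :
    essInf g (volume.restrict (cube a l)) ≠ ∞ := by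
  have hne : volume.restrict (cube a l) ≠ 0 := by
    rw [Ne, Measure.restrict_eq_zero, volume_cube]
    exact pow_ne_zero _ (by simpa using hl)
  have := ae_neBot.2 hne
  obtain ⟨x, hx⟩ := (ae_essInf_le (f := g) (μ := volume.restrict (cube a l))).exists
  exact ne_top_of_le_ne_top (hfin x) hx

theorem essInf_le_avg (a : EuclideanSpace ℝ (Fin n)) {l : ℝ} (hl : 0 < l)
    (g : EuclideanSpace ℝ (Fin n) → ℝ≥0∞) :
    essInf g (volume.restrict (cube a l)) ≤ avg (cube a l) g := by
  set e := essInf g (volume.restrict (cube a l)) with he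
  calc e = e * avg (cube a l) 1 := by rw [avg_one a hl, mul_one]
    _ = (volume (cube a l))⁻¹ * ∫⁻ _x in cube a l, e := by
        simp [avg]
        ring
    _ ≤ avg (cube a l) g := mul_le_mul_right (lintegral_mono_ae ae_essInf_le) _

end Averages

/-! ### Weights and the `A_{p,q}` constant. -/

section Weights

variable {n : ℕ} {p q : ℝ} {w : EuclideanSpace ℝ (Fin n) → ℝ}

theorem wpow_congr {w₀ : EuclideanSpace ℝ (Fin n) → ℝ} (h : w =ᵐ[volume] w₀) (s : ℝ) :
    wpow w s =ᵐ[volume] wpow w₀ s := by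
  filter_upwards [h] with x hx
  rw [wpow, wpow, hx]

theorem apqConst_congr {w₀ : EuclideanSpace ℝ (Fin n) → ℝ} (h : w =ᵐ[volume] w₀) :
    apqConst p q w = apqConst p q w₀ := by
  have h1 : ∀ a l, essInf (wpow w q) (volume.restrict (cube a l)) =
      essInf (wpow w₀ q) (volume.restrict (cube a l)) := fun a l =>
    essInf_congr_ae (ae_restrict_of_ae (wpow_congr h q))
  simp only [apqConst, avg_congr (wpow_congr h _), h1]

theorem measurable_wpow (hw : Measurable w) (s : ℝ) : Measurable (wpow w s) :=
  hw.ennreal_ofReal.pow_const s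

theorem wpow_ne_zero (hpos : ∀ x, 0 < w x) (s : ℝ) (x : EuclideanSpace ℝ (Fin n)) :
    wpow w s x ≠ 0 := by
  rw [wpow, ENNReal.ofReal_rpow_of_pos (hpos x)]
  simpa using Real.rpow_pos_of_pos (hpos x) s

theorem wpow_ne_top (hpos : ∀ x, 0 < w x) (s : ℝ) (x : EuclideanSpace ℝ (Fin n)) :
    wpow w s x ≠ ∞ := by
  rw [wpow, ENNReal.ofReal_rpow_of_pos (hpos x)]
  exact ENNReal.ofReal_ne_top

theorem wpow_rpow (s t : ℝ) (x : EuclideanSpace ℝ (Fin n)) :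
    wpow w s x ^ t = wpow w (s * t) x := (ENNReal.rpow_mul _ _ _).symm

/-- A weight agrees almost everywhere with a measurable function that is positive everywhere. -/
theorem MemApq.exists_measurable_pos (h : MemApq p q w) :
    ∃ w₀ : EuclideanSpace ℝ (Fin n) → ℝ, Measurable w₀ ∧ (∀ x, 0 < w₀ x) ∧ w =ᵐ[volume] w₀ := by
  classical
  refine ⟨fun x => if 0 < h.aemeasurable.mk w x then h.aemeasurable.mk w x else 1, ?_, ?_, ?_⟩
  · exact Measurable.ite (measurableSet_lt measurable_const h.aemeasurable.measurable_mk)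
      h.aemeasurable.measurable_mk measurable_const
  · intro x
    dsimp only
    split_ifs with hx
    · exact hx
    · exact one_pos
  · filter_upwards [h.aemeasurable.ae_eq_mk, h.pos] with x hx hx0
    rw [if_pos (hx ▸ hx0)]
    exact hx

/-- The defining inequality of `A_{1,q}`. -/
theorem avg_le_of_apqConst_one_lt {c : ℝ≥0∞} (hc : apqConst 1 q w < c)
    (a : EuclideanSpace ℝ (Fin n)) {l : ℝ} (hl : 0 < l) :
    avg (cube a l) (wpow w q) ≤ c * essInf (wpow w q) (volume.restrict (cube a l)) := by
  rw [apqConst, if_pos rfl, sInf_lt_iff] at hc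
  obtain ⟨c', hc', hlt⟩ := hc
  exact (hc' a l hl).trans (mul_le_mul_left hlt.le _)

/-- The defining inequality of `A_{p,q}` for `p ≠ 1`. -/
theorem avg_mul_avg_le_apqConst (hp : p ≠ 1) (a : EuclideanSpace ℝ (Fin n)) {l : ℝ} (hl : 0 < l) :
    avg (cube a l) (wpow w q) *
      avg (cube a l) (wpow w (-p.conjExponent)) ^ (q / p.conjExponent) ≤ apqConst p q w := by
  rw [apqConst, if_neg hp]
  exact le_iSup_of_le a (le_iSup₂_of_le l hl le_rfl)

/-- For `p = 1` the essential infimum is at most the average. For `p > 1`, apply Hölder on a unit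
cube to `1 = w^s w^(-s)`. The bound makes powers of the constant monotone in the exponent. -/
theorem one_le_apqConst (hp : 1 ≤ p) (hq : 0 < q) (hw : Measurable w) (hpos : ∀ x, 0 < w x) :
    1 ≤ apqConst p q w := by
  rcases hp.eq_or_lt with rfl | hp
  · rw [apqConst, if_pos rfl]
    refine le_sInf fun c hc => ?_
    have h1 := (essInf_le_avg (0 : EuclideanSpace ℝ (Fin n)) one_pos (wpow w q)).trans
      (hc 0 1 one_pos)
    have ht := essInf_cube_ne_top (0 : EuclideanSpace ℝ (Fin n)) one_pos (wpow_ne_top hpos q)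
    have h0 : essInf (wpow w q) (volume.restrict (cube 0 1)) ≠ 0 := by
      intro h0
      have := hc 0 1 one_pos
      rw [h0, mul_zero, nonpos_iff_eq_zero] at this
      exact avg_ne_zero 0 one_pos (measurable_wpow hw q) (wpow_ne_zero hpos q) this
    exact (ENNReal.mul_le_mul_iff_left h0 ht).1 (by rwa [one_mul])
  · have hpp : p.HolderConjugate p.conjExponent := Real.HolderConjugate.conjExponent hp
    set p' := p.conjExponent with hp'
    have hp'0 : 0 < p' := hpp.symm.pos
    -- With `s = q / (1 + q/p')`, these exponents turn `w^s` and `w^(-s)` into `w^q` and `w^(-p')`.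
    have hconj : (1 + q / p').HolderConjugate (1 + p' / q) := by
      rw [Real.holderConjugate_iff]
      refine ⟨by linarith [div_pos hq hp'0], ?_⟩
      field_simp
      ring
    refine le_trans ?_ (avg_mul_avg_le_apqConst hp.ne' (0 : EuclideanSpace ℝ (Fin n)) one_pos)
    have hvol : volume (cube (0 : EuclideanSpace ℝ (Fin n)) 1) = 1 := by simp [volume_cube]
    have e1 : ∀ x, wpow w (q / (1 + q / p')) x * wpow w (-(q / (1 + q / p'))) x = 1 := by
      intro x
      rw [wpow, wpow, ENNReal.rpow_neg, ENNReal.mul_inv_cancel]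
      · exact wpow_ne_zero hpos _ x
      · exact wpow_ne_top hpos _ x
    have hH := ENNReal.lintegral_mul_le_Lp_mul_Lq
      (volume.restrict (cube (0 : EuclideanSpace ℝ (Fin n)) 1)) hconj
      (measurable_wpow hw (q / (1 + q / p'))).aemeasurable
      (measurable_wpow hw (-(q / (1 + q / p')))).aemeasurable
    simp_rw [Pi.mul_apply, e1, wpow_rpow] at hH
    have e2 : q / (1 + q / p') * (1 + q / p') = q := div_mul_cancel₀ _ hconj.pos.ne'
    have e3 : -(q / (1 + q / p')) * (1 + p' / q) = -p' := by
      have : p' + q ≠ 0 := by positivity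
      have : q + p' ≠ 0 := by positivity
      field_simp
      ring
    rw [e2, e3] at hH
    simp only [lintegral_const, Measure.restrict_apply_univ, hvol, mul_one] at hH
    simp only [avg, hvol, inv_one, one_mul]
    have h2 := ENNReal.rpow_le_rpow hH hconj.nonneg
    rw [ENNReal.one_rpow, ENNReal.mul_rpow_of_nonneg _ _ hconj.nonneg, ← ENNReal.rpow_mul,
      ← ENNReal.rpow_mul, one_div_mul_cancel hconj.pos.ne', ENNReal.rpow_one] at h2
    have e4 : 1 / (1 + p' / q) * (1 + q / p') = q / p' := by
      have : p' + q ≠ 0 := by positivity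
      have : q + p' ≠ 0 := by positivity
      field_simp
      ring
    rwa [e4] at h2

theorem avg_wpow_ne_top (hp : 1 ≤ p) (hw : Measurable w) (hpos : ∀ x, 0 < w x)
    (hA : apqConst p q w < ∞) (hq : 0 < q) (a : EuclideanSpace ℝ (Fin n)) {l : ℝ} (hl : 0 < l) :
    avg (cube a l) (wpow w q) ≠ ∞ := by
  rcases hp.eq_or_lt with rfl | hp
  · obtain ⟨c, hc, hct⟩ := exists_between hA
    exact ne_top_of_le_ne_top
      (ENNReal.mul_ne_top hct.ne (essInf_cube_ne_top a hl (wpow_ne_top hpos q)))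
      (avg_le_of_apqConst_one_lt hc a hl)
  · have hpp : p.HolderConjugate p.conjExponent := Real.HolderConjugate.conjExponent hp
    have hp'0 : 0 < p.conjExponent := hpp.symm.pos
    intro h
    have h1 := avg_mul_avg_le_apqConst (q := q) (w := w) hp.ne' a hl
    rw [h, ENNReal.top_mul] at h1
    · exact hA.not_ge h1
    · have := avg_ne_zero a hl (measurable_wpow hw (-p.conjExponent))
        (wpow_ne_zero hpos (-p.conjExponent))
      rw [Ne, ENNReal.rpow_eq_zero_iff_of_pos (by positivity)]
      exact this

theorem avg_wpow_conjExponent_ne_top (hp : 1 < p) (hw : Measurable w) (hpos : ∀ x, 0 < w x)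
    (hA : apqConst p q w < ∞) (hq : 0 < q) (a : EuclideanSpace ℝ (Fin n)) {l : ℝ} (hl : 0 < l) :
    avg (cube a l) (wpow w (-p.conjExponent)) ≠ ∞ := by
  have hpp : p.HolderConjugate p.conjExponent := Real.HolderConjugate.conjExponent hp
  have hp'0 : 0 < p.conjExponent := hpp.symm.pos
  intro h
  have h1 := avg_mul_avg_le_apqConst (q := q) (w := w) hp.ne' a hl
  rw [h, ENNReal.top_rpow_of_pos (by positivity), ENNReal.mul_top] at h1
  · exact hA.not_ge h1
  · exact avg_ne_zero a hl (measurable_wpow hw q) (wpow_ne_zero hpos q)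

theorem withDensity_ball_ne_top {u : EuclideanSpace ℝ (Fin n) → ℝ≥0∞}
    (h : ∀ (a : EuclideanSpace ℝ (Fin n)) (l : ℝ), 0 < l → avg (cube a l) u ≠ ∞) (R : ℝ) :
    volume.withDensity u (ball 0 R) ≠ ∞ := by
  rcases le_or_gt R 0 with hR | hR
  · simp [ball_eq_empty.2 hR]
  rw [withDensity_apply']
  refine ne_top_of_le_ne_top ?_
    (lintegral_mono_set (ball_subset_closedBall.trans (closedBall_subset_cube 0 R)))
  rw [lintegral_cube_eq _ (by positivity)]
  exact ENNReal.mul_ne_top (by finiteness) (h _ _ (by positivity))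

end Weights

/-! ### The endpoint inequality with the maximal function. -/

section Endpoint

variable {n : ℕ} {α : ℝ}

/-- Testing on sets of finite measure when the densities on balls are controlled by `M`. -/
theorem lintegral_mul_setLIntegral_rieszKernel_le (hα : 0 < α) (hαn : α < n)
    (U : Measure (EuclideanSpace ℝ (Fin n))) (f : EuclideanSpace ℝ (Fin n) → ℂ)
    {S : Set (EuclideanSpace ℝ (Fin n))} (hS : U S ≠ ∞) {M : EuclideanSpace ℝ (Fin n) → ℝ≥0∞}
    (hM : ∀ᵐ y, ∀ s : ℝ, 0 < s → U.restrict S (ball y s) ≤ M y * ENNReal.ofReal s ^ n) :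
    ∫⁻ y, ‖f y‖ₑ * ∫⁻ x in S, rieszKernel α x y ∂U ≤
      ENNReal.ofReal (n / α) * (∫⁻ y, ‖f y‖ₑ * M y ^ (1 - α / n)) * U S ^ (α / n) := by
  have hn : (0 : ℝ) < n := hα.trans hαn
  have hθ : 0 < α / n := by positivity
  have hc : ENNReal.ofReal (n / α) * U S ^ (α / n) ≠ ∞ :=
    ENNReal.mul_ne_top ENNReal.ofReal_ne_top (ENNReal.rpow_ne_top_of_nonneg hθ.le hS)
  calc ∫⁻ y, ‖f y‖ₑ * ∫⁻ x in S, rieszKernel α x y ∂U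
      ≤ ∫⁻ y, ENNReal.ofReal (n / α) * U S ^ (α / n) * (‖f y‖ₑ * M y ^ (1 - α / n)) := by
        refine lintegral_mono_ae ?_
        filter_upwards [hM] with y hy
        have := lintegral_rieszKernel_le hα hαn (U.restrict S) (by simpa using hS) y (M y) hy
        rw [Measure.restrict_apply_univ] at this
        refine (mul_le_mul_right this _).trans_eq ?_
        ring
    _ = _ := by
        rw [lintegral_const_mul' _ _ hc]
        ring

theorem withDensity_ball_le_maximalFunction (u : EuclideanSpace ℝ (Fin n) → ℝ)
    (y : EuclideanSpace ℝ (Fin n)) {s : ℝ} (hs : 0 < s) :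
    volume.withDensity (fun x => ENNReal.ofReal (u x)) (ball y s) ≤
      2 ^ n * maximalFunction u y * ENNReal.ofReal s ^ n := by
  have hsub : ball y s ⊆ cube (cornerShift y s) (2 * s) :=
    ball_subset_closedBall.trans (closedBall_subset_cube y s)
  calc volume.withDensity (fun x => ENNReal.ofReal (u x)) (ball y s)
      = ∫⁻ x in ball y s, ENNReal.ofReal (u x) := withDensity_apply' _ _
    _ ≤ ∫⁻ x in cube (cornerShift y s) (2 * s), ‖u x‖ₑ :=
        lintegral_mono' (Measure.restrict_mono hsub le_rfl) fun x => Real.ofReal_le_enorm _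
    _ = ENNReal.ofReal (2 * s) ^ n * avg (cube (cornerShift y s) (2 * s)) fun x => ‖u x‖ₑ :=
        lintegral_cube_eq _ (by positivity) _
    _ ≤ ENNReal.ofReal (2 * s) ^ n * maximalFunction u y := by
        gcongr
        exact le_iSup_of_le (cornerShift y s)
          (le_iSup₂_of_le (2 * s) ⟨by positivity, hsub (mem_ball_self hs)⟩ le_rfl)
    _ = _ := by
        rw [ENNReal.ofReal_mul zero_le_two, mul_pow, ENNReal.ofReal_ofNat]
        ring

/-- The endpoint inequality of Fefferman–Stein type. -/
theorem weakNorm_le_lintegral_maximalFunction (hα : 0 < α) (hαn : α < n) :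
    ∃ c : ℝ≥0, ∀ u : EuclideanSpace ℝ (Fin n) → ℝ, LocallyIntegrable u volume →
      ∀ f : EuclideanSpace ℝ (Fin n) → ℂ, AEStronglyMeasurable f volume →
        ∫⁻ x, ‖f x‖ₑ * maximalFunction u x ^ (1 - α / n) < ∞ →
          (∀ᵐ x ∂(volume.withDensity fun x => ENNReal.ofReal (u x)), RieszConverges α f x) ∧
          weakNorm (Real.conjExponent (n / α)) (fun x => ENNReal.ofReal (u x))
              (rieszPotential α f) ≤
            c * ∫⁻ x, ‖f x‖ₑ * maximalFunction u x ^ (1 - α / n) := by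
  have hn : (0 : ℝ) < n := hα.trans hαn
  have hθ1 : 0 ≤ 1 - α / n := sub_nonneg.2 ((div_lt_one hn).2 hαn).le
  refine ⟨(n / α).toNNReal * ((2 : ℝ≥0) ^ n) ^ (1 - α / n), fun u hu f hf hfin => ?_⟩
  have hq : (n / α).HolderConjugate (Real.conjExponent (n / α)) :=
    Real.HolderConjugate.conjExponent ((one_lt_div hα).2 hαn)
  -- For this `q` the power of `U S` required by testing is exactly the one in Hedberg's inequality.
  have hq1 : 1 - 1 / Real.conjExponent (n / α) = α / n := by
    have := hq.inv_add_inv_eq_one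
    rw [inv_div] at this
    rw [one_div]
    linarith
  refine weakNorm_le_of_testing (fun R => ?_) hf ?_ hq.symm.pos fun S hSm hS => ?_
  · have h1 : IntegrableOn u (closedBall 0 R) :=
      hu.integrableOn_isCompact (isCompact_closedBall _ _)
    rw [withDensity_apply']
    refine ne_top_of_le_ne_top h1.2.ne ?_
    exact lintegral_mono' (Measure.restrict_mono ball_subset_closedBall le_rfl)
      fun x => Real.ofReal_le_enorm _
  · exact ENNReal.mul_ne_top ENNReal.coe_ne_top hfin.ne
  · rw [hq1]
    refine (lintegral_mul_setLIntegral_rieszKernel_le hα hαn _ f hS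
      (M := fun y => 2 ^ n * maximalFunction u y) (Filter.Eventually.of_forall fun y s hs =>
        (Measure.restrict_apply_le _ _).trans
          (withDensity_ball_le_maximalFunction u y hs))).trans_eq ?_
    congr 1
    have hsplit : ∀ y, ‖f y‖ₑ * (2 ^ n * maximalFunction u y) ^ (1 - α / n) =
        (2 ^ n) ^ (1 - α / n) * (‖f y‖ₑ * maximalFunction u y ^ (1 - α / n)) := fun y => by
      rw [ENNReal.mul_rpow_of_nonneg _ _ hθ1, mul_left_comm]
    simp_rw [hsplit]
    rw [lintegral_const_mul' _ _ (ENNReal.rpow_ne_top_of_nonneg hθ1 (by finiteness)), ← mul_assoc]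
    push_cast [ENNReal.coe_rpow_of_nonneg _ hθ1]
    rfl

end Endpoint

/-! ### Buckley's bound by Lerner's argument. -/

section Lerner

variable {n : ℕ}

/-- Buckley's bound for the maximal function on functions of the form `u 1_S`, where `u` and
`v = u ^ (-σ)` are dual weights of characteristic at most `B`, by Lerner's argument. -/
theorem exists_density_bound (hn : 0 < n) {σ : ℝ} (hσ : 0 < σ) :
    ∃ C : ℝ≥0, ∀ (u : EuclideanSpace ℝ (Fin n) → ℝ≥0∞) (B : ℝ≥0∞), B ≠ ∞ → Measurable u →
      (∀ x, u x ≠ 0) → (∀ x, u x ≠ ∞) →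
      (∀ (a : EuclideanSpace ℝ (Fin n)) (l : ℝ), 0 < l → avg (cube a l) u ≠ ∞) →
      (∀ (a : EuclideanSpace ℝ (Fin n)) (l : ℝ), 0 < l →
        avg (cube a l) (fun x => u x ^ (-σ)) ≠ ∞) →
      (∀ (a : EuclideanSpace ℝ (Fin n)) (l : ℝ), 0 < l →
        avg (cube a l) u * avg (cube a l) (fun x => u x ^ (-σ)) ^ (1 / σ) ≤ B) →
      ∀ S : Set (EuclideanSpace ℝ (Fin n)), MeasurableSet S →
        ∃ F : EuclideanSpace ℝ (Fin n) → ℝ≥0∞, Measurable F ∧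
          (∀ y, ∀ r : ℝ, 0 < r → (volume.withDensity u).restrict S (ball y r) ≤
            F y * ENNReal.ofReal r ^ n) ∧
          ∫⁻ y, u y ^ (-σ) * F y ^ (1 + σ) ≤
            C * B ^ (1 + σ) * volume.withDensity u S := by
  obtain ⟨C₁, hC₁⟩ := exists_centeredMaximal_strong (EuclideanSpace ℝ (Fin n))
    (p := (1 + σ) / σ) ((one_lt_div hσ).2 (by linarith))
  obtain ⟨C₂, hC₂⟩ := exists_centeredMaximal_strong (EuclideanSpace ℝ (Fin n))
    (p := 1 + σ) (by linarith)
  have : Nontrivial (EuclideanSpace ℝ (Fin n)) := by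
    have : Nonempty (Fin n) := ⟨⟨0, hn⟩⟩
    infer_instance
  set κ : ℝ≥0∞ := volume (ball (0 : EuclideanSpace ℝ (Fin n)) 1) with hκ
  have hκ0 : κ ≠ 0 := (measure_ball_pos _ _ one_pos).ne'
  have hκt : κ ≠ ∞ := measure_ball_lt_top.ne
  set K : ℝ≥0∞ := (κ⁻¹ * (6 ^ n) ^ (1 + σ)) ^ (1 / σ) with hK
  have hKt : K ≠ ∞ := by
    refine ENNReal.rpow_ne_top_of_nonneg (by positivity) (ENNReal.mul_ne_top ?_ ?_)
    · simpa using hκ0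
    · exact ENNReal.rpow_ne_top_of_nonneg (by positivity) (by finiteness)
  refine ⟨K.toNNReal ^ (1 + σ) * C₁ * C₂, fun u B hBt hu hu0 hut hfu hfv hB S hS => ?_⟩
  set v : EuclideanSpace ℝ (Fin n) → ℝ≥0∞ := fun x => u x ^ (-σ) with hv
  have hvm : Measurable v := hu.pow_const _
  set U := volume.withDensity u with hU
  set V := volume.withDensity v with hV
  set m₁ := centeredMaximal U (S.indicator 1) with hm₁
  have hm₁m : Measurable m₁ := measurable_centeredMaximal _ _
  -- Chosen so that `v g = m₁^σ`, used for the pointwise bound, and `v g^((1+σ)/σ) = u m₁^(1+σ)`,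
  -- used to pass from the `V`-norm to the `U`-norm.
  set g : EuclideanSpace ℝ (Fin n) → ℝ≥0∞ := fun x => (m₁ x * u x) ^ σ with hg
  have hgm : Measurable g := (hm₁m.mul hu).pow_const _
  set m₂ := centeredMaximal V g with hm₂
  have hm₂m : Measurable m₂ := measurable_centeredMaximal _ _
  have hUQ : ∀ (a : EuclideanSpace ℝ (Fin n)) (l : ℝ), 0 < l →
      U (cube a l) = ENNReal.ofReal l ^ n * avg (cube a l) u := fun a l hl => by
    rw [hU, withDensity_apply', lintegral_cube_eq a hl]
  have hVQ : ∀ (a : EuclideanSpace ℝ (Fin n)) (l : ℝ), 0 < l →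
      V (cube a l) = ENNReal.ofReal l ^ n * avg (cube a l) v := fun a l hl => by
    rw [hV, withDensity_apply', lintegral_cube_eq a hl]
  have hUQt : ∀ (a : EuclideanSpace ℝ (Fin n)) (l : ℝ), 0 < l → U (cube a l) ≠ ∞ :=
    fun a l hl => by rw [hUQ a l hl]; exact ENNReal.mul_ne_top (by finiteness) (hfu a l hl)
  have hVQt : ∀ (a : EuclideanSpace ℝ (Fin n)) (l : ℝ), 0 < l → V (cube a l) ≠ ∞ :=
    fun a l hl => by rw [hVQ a l hl]; exact ENNReal.mul_ne_top (by finiteness) (hfv a l hl)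
  -- The characteristic condition raised to the power `σ` and cleared of denominators: `U(Q)^σ V(Q)
  -- ≤ B^σ |Q|^(1+σ)`.
  have hUV : ∀ (a : EuclideanSpace ℝ (Fin n)) (l : ℝ), 0 < l →
      U (cube a l) ^ σ * V (cube a l) ≤ B ^ σ * (ENNReal.ofReal l ^ n) ^ (1 + σ) := by
    intro a l hl
    have hl0 : ENNReal.ofReal l ^ n ≠ 0 := pow_ne_zero _ (by simpa using hl)
    have hlt : ENNReal.ofReal l ^ n ≠ ∞ := by finiteness
    have h1 := ENNReal.rpow_le_rpow (hB a l hl) hσ.le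
    rw [ENNReal.mul_rpow_of_nonneg _ _ hσ.le, ← ENNReal.rpow_mul, one_div_mul_cancel hσ.ne',
      ENNReal.rpow_one] at h1
    rw [hUQ a l hl, hVQ a l hl, ENNReal.mul_rpow_of_nonneg _ _ hσ.le,
      ENNReal.rpow_add _ _ hl0 hlt, ENNReal.rpow_one]
    calc _ = (ENNReal.ofReal l ^ n * (ENNReal.ofReal l ^ n) ^ σ) *
          (avg (cube a l) u ^ σ * avg (cube a l) v) := by ring
      _ ≤ (ENNReal.ofReal l ^ n * (ENNReal.ofReal l ^ n) ^ σ) * B ^ σ := by gcongr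
      _ = _ := by ring
  refine ⟨fun y => K * B * m₂ y ^ (1 / σ), (hm₂m.pow_const _).const_mul _, fun y r hr => ?_, ?_⟩
  · have hr0 : ENNReal.ofReal r ^ n ≠ 0 := pow_ne_zero _ (by simpa using hr)
    have hrt : ENNReal.ofReal r ^ n ≠ ∞ := by finiteness
    -- For `z ∈ B(y,r)` one has `B(y,r) ⊆ B(z,2r) ⊆ B(y,3r) ⊆ Q`. Thus `m₁ z ≥ m / U(Q)` on the
    -- whole ball, and the centered function can be averaged over it.
    set Q := cube (cornerShift y (3 * r)) (2 * (3 * r)) with hQ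
    have hQsub : closedBall y (3 * r) ⊆ Q := closedBall_subset_cube y (3 * r)
    have hl : 0 < 2 * (3 * r) := by positivity
    rw [Measure.restrict_apply measurableSet_ball]
    set m := U (ball y r ∩ S) with hm
    have hpt : ∀ z ∈ ball y r, m ≤ m₁ z * U Q := by
      intro z hz
      rw [mem_ball] at hz
      have hsub2 : closedBall z (2 * r) ⊆ closedBall y (3 * r) :=
        closedBall_subset_closedBall' (by linarith)
      have hsub1 : ball y r ⊆ ball z (2 * r) := ball_subset_ball' (by rw [dist_comm]; linarith)
      have h1 := lintegral_ball_le_centeredMaximal_mul (μ := U) (g := S.indicator 1) (x := z)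
        (r := 2 * r) (by positivity)
        (measure_ne_top_of_subset (hsub2.trans hQsub) (hUQt _ _ hl))
      rw [lintegral_indicator_one hS, Measure.restrict_apply hS] at h1
      calc m ≤ U (S ∩ ball z (2 * r)) := by
            rw [hm, inter_comm]
            exact measure_mono (inter_subset_inter_right _ hsub1)
        _ ≤ _ := h1
        _ ≤ m₁ z * U Q := by
            gcongr
            exact hsub2.trans hQsub
    have hgv : ∀ x, v x * g x = m₁ x ^ σ := by
      intro x
      rw [hv, hg]
      dsimp only
      rw [ENNReal.mul_rpow_of_nonneg _ _ hσ.le, mul_left_comm, ← ENNReal.rpow_add _ _ (hu0 x) (hut x)]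
      simp
    -- Integrate the `σ`-th power of the pointwise bound in `z`. The integral of `m₁^σ` is that of
    -- `g` against `V`, hence is controlled by `m₂ y`.
    have h2 : m ^ σ * volume (ball y r) ≤ U Q ^ σ * (m₂ y * V Q) := by
      calc m ^ σ * volume (ball y r) = ∫⁻ _z in ball y r, m ^ σ := by simp
        _ ≤ ∫⁻ z in ball y r, U Q ^ σ * (v z * g z) := by
            refine setLIntegral_mono' measurableSet_ball fun z hz => ?_
            rw [hgv, mul_comm, ← ENNReal.mul_rpow_of_nonneg _ _ hσ.le]
            exact ENNReal.rpow_le_rpow (hpt z hz) hσ.le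
        _ = U Q ^ σ * ∫⁻ z in ball y r, g z ∂V := by
            rw [lintegral_const_mul' _ _ (ENNReal.rpow_ne_top_of_nonneg hσ.le (hUQt _ _ hl)), hV,
              setLIntegral_withDensity_eq_setLIntegral_mul _ hvm hgm measurableSet_ball]
            rfl
        _ ≤ U Q ^ σ * (m₂ y * V (closedBall y r)) := by
            gcongr
            refine lintegral_ball_le_centeredMaximal_mul hr ?_
            exact measure_ne_top_of_subset
              ((closedBall_subset_closedBall (by linarith)).trans hQsub)
              (hVQt (cornerShift y (3 * r)) _ hl)
        _ ≤ U Q ^ σ * (m₂ y * V Q) := by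
            gcongr
            exact (closedBall_subset_closedBall (by linarith)).trans hQsub
    have hvol : volume (ball y r) = κ * ENNReal.ofReal r ^ n := by
      rw [Measure.addHaar_ball _ _ hr.le, finrank_euclideanSpace_fin, mul_comm,
        ENNReal.ofReal_pow hr.le]
    have hside : ENNReal.ofReal (2 * (3 * r)) ^ n = 6 ^ n * ENNReal.ofReal r ^ n := by
      rw [show 2 * (3 * r) = 6 * r by ring, ENNReal.ofReal_mul (by norm_num), mul_pow,
        ENNReal.ofReal_ofNat]
    have h3 : m ^ σ * (κ * ENNReal.ofReal r ^ n) ≤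
        (B ^ σ * ((6 ^ n) ^ (1 + σ) * (ENNReal.ofReal r ^ n) ^ σ) * m₂ y) *
          ENNReal.ofReal r ^ n := by
      rw [← hvol]
      refine h2.trans ?_
      calc U Q ^ σ * (m₂ y * V Q) = (U Q ^ σ * V Q) * m₂ y := by ring
        _ ≤ B ^ σ * (ENNReal.ofReal (2 * (3 * r)) ^ n) ^ (1 + σ) * m₂ y := by
            exact mul_le_mul_left (hUV _ _ hl) _
        _ = _ := by
            rw [hside, ENNReal.mul_rpow_of_nonneg _ _ (by positivity),
              ENNReal.rpow_add _ _ hr0 hrt, ENNReal.rpow_one]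
            ring
    have h4 : m ^ σ ≤ (K * B * m₂ y ^ (1 / σ) * ENNReal.ofReal r ^ n) ^ σ := by
      rw [← mul_assoc] at h3
      have h5 := (ENNReal.mul_le_mul_iff_left hr0 hrt).1 h3
      rw [ENNReal.mul_rpow_of_nonneg _ _ hσ.le, ENNReal.mul_rpow_of_nonneg _ _ hσ.le,
        ENNReal.mul_rpow_of_nonneg _ _ hσ.le, hK, ← ENNReal.rpow_mul, ← ENNReal.rpow_mul,
        one_div_mul_cancel hσ.ne', ENNReal.rpow_one, ENNReal.rpow_one]
      calc m ^ σ = κ⁻¹ * (m ^ σ * κ) := by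
            rw [mul_comm, mul_assoc, ENNReal.mul_inv_cancel hκ0 hκt, mul_one]
        _ ≤ κ⁻¹ * (B ^ σ * ((6 ^ n) ^ (1 + σ) * (ENNReal.ofReal r ^ n) ^ σ) * m₂ y) := by gcongr
        _ = _ := by ring
    exact (ENNReal.rpow_le_rpow_iff hσ).1 h4
  · have hσ1 : 0 < 1 + σ := by linarith
    have hsplit : ∀ y, v y * (K * B * m₂ y ^ (1 / σ)) ^ (1 + σ) =
        (K * B) ^ (1 + σ) * (v y * m₂ y ^ ((1 + σ) / σ)) := by
      intro y
      rw [ENNReal.mul_rpow_of_nonneg _ _ hσ1.le, ← ENNReal.rpow_mul, mul_left_comm]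
      congr 3
      field_simp
    have hgv : ∀ x, v x * g x ^ ((1 + σ) / σ) = u x * m₁ x ^ (1 + σ) := by
      intro x
      rw [hv, hg]
      dsimp only
      rw [← ENNReal.rpow_mul, mul_div_cancel₀ _ hσ.ne', ENNReal.mul_rpow_of_nonneg _ _ hσ1.le,
        mul_left_comm, ← ENNReal.rpow_add _ _ (hu0 x) (hut x), mul_comm]
      simp
    have hwd : ∀ (a h : EuclideanSpace ℝ (Fin n) → ℝ≥0∞), Measurable a → Measurable h →
        ∫⁻ x, a x * h x = ∫⁻ x, h x ∂volume.withDensity a := fun a h ha hh =>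
      (lintegral_withDensity_eq_lintegral_mul _ ha hh).symm
    calc ∫⁻ y, v y * (K * B * m₂ y ^ (1 / σ)) ^ (1 + σ)
        = (K * B) ^ (1 + σ) * ∫⁻ y, m₂ y ^ ((1 + σ) / σ) ∂V := by
          simp_rw [hsplit]
          rw [lintegral_const_mul' _ _ (ENNReal.rpow_ne_top_of_nonneg hσ1.le
            (ENNReal.mul_ne_top hKt hBt)), hwd v _ hvm (hm₂m.pow_const _)]
      _ ≤ (K * B) ^ (1 + σ) * (C₁ * ∫⁻ y, g y ^ ((1 + σ) / σ) ∂V) := by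
          gcongr
          exact hC₁ V g hgm
      _ = (K * B) ^ (1 + σ) * (C₁ * ∫⁻ y, m₁ y ^ (1 + σ) ∂U) := by
          rw [← hwd v _ hvm (hgm.pow_const _), ← hwd u _ hu (hm₁m.pow_const _)]
          simp_rw [hgv]
      _ ≤ (K * B) ^ (1 + σ) * (C₁ * (C₂ * ∫⁻ y, S.indicator 1 y ^ (1 + σ) ∂U)) := by
          gcongr
          exact hC₂ U _ (measurable_one.indicator hS)
      _ = (K * B) ^ (1 + σ) * (C₁ * (C₂ * U S)) := by
          congr 3
          rw [← lintegral_indicator_one hS]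
          refine lintegral_congr fun x => ?_
          by_cases hx : x ∈ S <;> simp [hx, hσ1]
      _ = _ := by
          rw [ENNReal.mul_rpow_of_nonneg _ _ hσ1.le]
          push_cast [ENNReal.coe_rpow_of_nonneg _ hσ1.le, ENNReal.coe_toNNReal hKt]
          ring

end Lerner

/-! ### The weak type bound for `A_{p,q}` weights. -/

section UpperBound

variable {n : ℕ} {α : ℝ}

theorem MemWeightedLp.aestronglyMeasurable {p : ℝ} {w : EuclideanSpace ℝ (Fin n) → ℝ}
    (hw : Measurable w) (hpos : ∀ x, 0 < w x) {f : EuclideanSpace ℝ (Fin n) → ℂ}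
    (hf : MemWeightedLp p w f) : AEStronglyMeasurable f volume := by
  have h1 : AEMeasurable (fun x => ((w x : ℂ) * f x) / (w x : ℂ)) volume :=
    hf.1.aemeasurable.div (Complex.measurable_ofReal.comp hw).aemeasurable
  refine (h1.congr (Filter.Eventually.of_forall fun x => ?_)).aestronglyMeasurable
  have : (w x : ℂ) ≠ 0 := by exact_mod_cast (hpos x).ne'
  exact mul_div_cancel_left₀ _ this

theorem weightedLpNorm_eq {p : ℝ} (hp : 0 < p) {w : EuclideanSpace ℝ (Fin n) → ℝ}
    (hw : ∀ x, 0 ≤ w x) (f : EuclideanSpace ℝ (Fin n) → ℂ) :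
    weightedLpNorm p w f = (∫⁻ x, (‖f x‖ₑ * ENNReal.ofReal (w x)) ^ p) ^ (1 / p) := by
  rw [weightedLpNorm, eLpNorm_eq_lintegral_rpow_enorm_toReal (by simpa using hp)
    ENNReal.ofReal_ne_top, ENNReal.toReal_ofReal hp.le]
  congr 1
  refine lintegral_congr fun x => ?_
  rw [enorm_mul, mul_comm, ← ofReal_norm (w x : ℂ), Complex.norm_real,
    Real.norm_of_nonneg (hw x)]

/-- The essential infimum over a cube bounds `u y` from below only for almost every `y` in that
cube, so a single null set requires countably many cubes: corners from a dense sequence, rational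
sides. A corner within `s` of `y - 2s(1,…,1)` and a side in `(4s, 5s)` still cover `B(y,s)`, whence
`5 ^ n`. -/
theorem ae_withDensity_ball_le {u : EuclideanSpace ℝ (Fin n) → ℝ≥0∞} {c : ℝ≥0∞}
    (hc : ∀ (a : EuclideanSpace ℝ (Fin n)) (l : ℝ), 0 < l →
      avg (cube a l) u ≤ c * essInf u (volume.restrict (cube a l))) :
    ∀ᵐ y, ∀ s : ℝ, 0 < s →
      volume.withDensity u (ball y s) ≤ 5 ^ n * (c * u y) * ENNReal.ofReal s ^ n := by
  have hae : ∀ᵐ y, ∀ (k : ℕ) (l : ℚ),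
      y ∈ cube (TopologicalSpace.denseSeq (EuclideanSpace ℝ (Fin n)) k) l →
        essInf u (volume.restrict
          (cube (TopologicalSpace.denseSeq (EuclideanSpace ℝ (Fin n)) k) l)) ≤ u y := by
    rw [ae_all_iff]
    intro k
    rw [ae_all_iff]
    intro l
    exact (ae_restrict_iff' (measurableSet_cube _ _)).1 ae_essInf_le
  filter_upwards [hae] with y hy s hs
  obtain ⟨k, hk⟩ := (TopologicalSpace.denseRange_denseSeq
    (EuclideanSpace ℝ (Fin n))).exists_dist_lt (cornerShift y (2 * s)) hs
  obtain ⟨l, hl4, hl5⟩ := exists_rat_btwn (show 4 * s < 5 * s by linarith)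
  set a := TopologicalSpace.denseSeq (EuclideanSpace ℝ (Fin n)) k with ha
  have hl0 : (0 : ℝ) < l := by linarith
  have hsub : ball y s ⊆ cube a l := by
    intro z hz i
    have h1 := abs_lt.1 ((abs_sub_apply_le_dist z y i).trans_lt hz)
    have h2 := abs_lt.1 ((abs_sub_apply_le_dist (cornerShift y (2 * s)) a i).trans_lt hk)
    change -s < (y i - 2 * s) - a i ∧ (y i - 2 * s) - a i < s at h2
    constructor <;> linarith [h1.1, h1.2, h2.1, h2.2]
  calc volume.withDensity u (ball y s) = ∫⁻ x in ball y s, u x := withDensity_apply' _ _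
    _ ≤ ∫⁻ x in cube a l, u x := lintegral_mono_set hsub
    _ = ENNReal.ofReal l ^ n * avg (cube a l) u := lintegral_cube_eq _ hl0 _
    _ ≤ ENNReal.ofReal (5 * s) ^ n * (c * u y) := by
        gcongr
        refine (hc a l hl0).trans ?_
        gcongr
        exact hy k l (hsub (mem_ball_self hs))
    _ = _ := by
        rw [ENNReal.ofReal_mul (by norm_num), mul_pow, ENNReal.ofReal_ofNat]
        ring

theorem weakBound_one_of_measurable (hα : 0 < α) (hαn : α < n) {q : ℝ} (hq : 1 / q = 1 - α / n)
    {w : EuclideanSpace ℝ (Fin n) → ℝ} (hw : Measurable w) (hpos : ∀ x, 0 < w x)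
    (hA : apqConst 1 q w < ∞) {f : EuclideanSpace ℝ (Fin n) → ℂ} (hf : MemWeightedLp 1 w f) :
    (∀ᵐ x ∂volume.withDensity (wpow w q), RieszConverges α f x) ∧
      WeakBound α 1 q (1 - α / n) ((n / α).toNNReal * (5 ^ n * 2) ^ (1 - α / n)) w f := by
  have hn : (0 : ℝ) < n := hα.trans hαn
  have hθ1 : 0 < 1 - α / n := sub_pos.2 ((div_lt_one hn).2 hαn)
  have hq0 : 0 < q := one_div_pos.1 (hq ▸ hθ1)
  -- Strictly above the infimum, so the `A_{1,q}` inequality holds with `c` without showing that the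
  -- infimum is attained.
  set c := 2 * apqConst 1 q w with hc
  have hA1 := one_le_apqConst le_rfl hq0 hw hpos
  have hAc : apqConst 1 q w < c := by
    rw [hc, two_mul]
    exact ENNReal.lt_add_right hA.ne (one_pos.trans_le hA1).ne'
  have hct : c ≠ ∞ := ENNReal.mul_ne_top (by simp) hA.ne
  refine weakNorm_le_of_testing (withDensity_ball_ne_top fun a l hl =>
    avg_wpow_ne_top le_rfl hw hpos hA hq0 a hl) (hf.aestronglyMeasurable hw hpos) ?_ hq0
    fun S hSm hS => ?_
  · exact ENNReal.mul_ne_top (ENNReal.mul_ne_top ENNReal.coe_ne_top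
      (ENNReal.rpow_ne_top_of_nonneg hθ1.le hA.ne)) hf.2.ne
  have hM := ae_withDensity_ball_le fun a l hl => avg_le_of_apqConst_one_lt hAc a hl
  have h1 := lintegral_mul_setLIntegral_rieszKernel_le hα hαn (volume.withDensity (wpow w q)) f hS
    (M := fun y => 5 ^ n * (c * wpow w q y))
    (hM.mono fun y hy s hs => (Measure.restrict_apply_le _ _).trans (hy s hs))
  rw [hq, sub_sub_cancel]
  refine h1.trans_eq ?_
  congr 1
  have hsplit : ∀ y, ‖f y‖ₑ * (5 ^ n * (c * wpow w q y)) ^ (1 - α / n) =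
      (5 ^ n * c) ^ (1 - α / n) * (‖f y‖ₑ * ENNReal.ofReal (w y)) := by
    intro y
    have : q * (1 - α / n) = 1 := by rw [← hq, mul_one_div_cancel hq0.ne']
    rw [← mul_assoc, ENNReal.mul_rpow_of_nonneg _ _ hθ1.le, wpow_rpow, this, wpow,
      ENNReal.rpow_one, mul_left_comm]
  simp_rw [hsplit]
  rw [lintegral_const_mul' _ _ (ENNReal.rpow_ne_top_of_nonneg hθ1.le
    (ENNReal.mul_ne_top (by finiteness) hct)), weightedLpNorm_eq one_pos fun x => (hpos x).le]
  simp only [ENNReal.rpow_one, div_one]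
  rw [hc, ← mul_assoc (5 ^ n) 2, ENNReal.mul_rpow_of_nonneg (5 ^ n * 2) _ hθ1.le, ← mul_assoc,
    ← mul_assoc]
  push_cast [ENNReal.coe_rpow_of_nonneg _ hθ1.le]
  rfl

theorem exists_weakBound_of_measurable (hα : 0 < α) (hαn : α < n) {p q : ℝ} (hp : 1 < p)
    (hpα : p < n / α) (hq : 1 / q = 1 / p - α / n) :
    ∃ c : ℝ≥0, ∀ w : EuclideanSpace ℝ (Fin n) → ℝ, Measurable w → (∀ x, 0 < w x) →
      apqConst p q w < ∞ → ∀ f : EuclideanSpace ℝ (Fin n) → ℂ, MemWeightedLp p w f →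
        (∀ᵐ x ∂volume.withDensity (wpow w q), RieszConverges α f x) ∧
          WeakBound α p q (1 - α / n) c w f := by
  have hn : (0 : ℝ) < n := hα.trans hαn
  have hθ0 : 0 < α / n := by positivity
  have hθ1 : 0 < 1 - α / n := sub_pos.2 ((div_lt_one hn).2 hαn)
  have hp0 : 0 < p := one_pos.trans hp
  have hq0 : 0 < q := by
    refine one_div_pos.1 (hq ▸ sub_pos.2 ?_)
    rw [← inv_div, ← one_div]
    exact one_div_lt_one_div_of_lt hp0 hpα
  have hpp : p.HolderConjugate p.conjExponent := Real.HolderConjugate.conjExponent hp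
  set p' := p.conjExponent with hp'
  have hp'0 : 0 < p' := hpp.symm.pos
  have hinv := hpp.inv_add_inv_eq_one
  rw [inv_eq_one_div, inv_eq_one_div] at hinv
  have hσ : 0 < p' / q := by positivity
  -- With `σ = p'/q` and `u = w^q` one has `u^(-σ) = w^(-p')` and `1/σ = q/p'`, so the hypothesis of
  -- `exists_density_bound` is the `A_{p,q}` condition. This identity matches the exponent left by
  -- Hölder with `1 + σ`.
  have hs : (1 - α / n) * p' = 1 + p' / q := by
    have : 1 - α / n = 1 / p' + 1 / q := by linarith
    rw [this]
    field_simp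
  obtain ⟨C, hC⟩ := exists_density_bound (n := n) (by exact_mod_cast hn) hσ
  refine ⟨(n / α).toNNReal * C ^ (1 / p'), fun w hw hpos hA f hf => ?_⟩
  have hfm := hf.aestronglyMeasurable hw hpos
  have hv : ∀ x, wpow w q x ^ (-(p' / q)) = wpow w (-p') x := by
    intro x
    rw [wpow_rpow]
    congr 1
    field_simp
  refine weakNorm_le_of_testing (withDensity_ball_ne_top fun a l hl =>
    avg_wpow_ne_top hp.le hw hpos hA hq0 a hl) hfm ?_ hq0 fun S hSm hS => ?_
  · exact ENNReal.mul_ne_top (ENNReal.mul_ne_top ENNReal.coe_ne_top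
      (ENNReal.rpow_ne_top_of_nonneg hθ1.le hA.ne)) hf.2.ne
  obtain ⟨F, hFm, hF, hFint⟩ := hC (wpow w q) (apqConst p q w) hA.ne (measurable_wpow hw q)
    (wpow_ne_zero hpos q) (wpow_ne_top hpos q)
    (fun a l hl => avg_wpow_ne_top hp.le hw hpos hA hq0 a hl)
    (fun a l hl => by
      simp_rw [hv]
      exact avg_wpow_conjExponent_ne_top hp hw hpos hA hq0 a hl)
    (fun a l hl => by
      simp_rw [hv, one_div_div]
      exact avg_mul_avg_le_apqConst hp.ne' a hl) S hSm
  simp_rw [hv] at hFint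
  set A := apqConst p q w with hAdef
  set u := volume.withDensity (wpow w q) S with hu
  have hHolder : ∫⁻ y, ‖f y‖ₑ * F y ^ (1 - α / n) ≤
      weightedLpNorm p w f * (C * A ^ (1 + p' / q) * u) ^ (1 / p') := by
    have h1 := ENNReal.lintegral_mul_le_Lp_mul_Lq volume hpp
      (f := fun y => ‖f y‖ₑ * ENNReal.ofReal (w y))
      (g := fun y => wpow w (-1) y * F y ^ (1 - α / n))
      (hfm.aemeasurable.enorm.mul hw.ennreal_ofReal.aemeasurable)
      ((measurable_wpow hw _).mul (hFm.pow_const _)).aemeasurable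
    rw [← weightedLpNorm_eq hp0 fun x => (hpos x).le] at h1
    refine le_trans (le_of_eq ?_) (h1.trans ?_)
    · refine lintegral_congr fun y => ?_
      simp only [Pi.mul_apply]
      have h2 : ENNReal.ofReal (w y) * wpow w (-1) y = 1 := by
        rw [wpow, ENNReal.rpow_neg_one, ENNReal.mul_inv_cancel (by simpa using hpos y) (by simp)]
      rw [mul_assoc, ← mul_assoc (ENNReal.ofReal (w y)), h2, one_mul]
    · gcongr
      refine le_trans (le_of_eq ?_) hFint
      refine lintegral_congr fun y => ?_
      rw [ENNReal.mul_rpow_of_nonneg _ _ hp'0.le, ← ENNReal.rpow_mul, hs, wpow_rpow, neg_one_mul]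
  have h1 := lintegral_mul_setLIntegral_rieszKernel_le hα hαn _ f hS
    (Filter.Eventually.of_forall hF)
  have e1 : 1 - 1 / q = 1 / p' + α / n := by linarith
  have e2 : (1 + p' / q) * (1 / p') = 1 - α / n := by
    rw [← hs]
    field_simp
  have hp'i : 0 ≤ 1 / p' := by positivity
  calc _ ≤ _ := h1
    _ ≤ ENNReal.ofReal (n / α) * (weightedLpNorm p w f *
          (C * A ^ (1 + p' / q) * u) ^ (1 / p')) * u ^ (α / n) := by gcongr
    _ = _ := by
        rw [ENNReal.mul_rpow_of_nonneg _ _ hp'i, ENNReal.mul_rpow_of_nonneg _ _ hp'i,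
          ← ENNReal.rpow_mul, e2, e1, ENNReal.rpow_add_of_nonneg _ _ hp'i hθ0.le]
        push_cast [ENNReal.coe_rpow_of_nonneg _ hp'i]
        rw [ENNReal.ofReal]
        ring

/-- Every quantity is unchanged when `w` is modified on a null set. Positivity everywhere of the
representative upgrades convergence from `w^q dx`-almost everywhere to Lebesgue almost everywhere.
-/
theorem exists_weakBound (hα : 0 < α) (hαn : α < n) {p q : ℝ} (hp : 1 ≤ p)
    (hpα : p < n / α) (hq : 1 / q = 1 / p - α / n) :
    ∃ c : ℝ≥0, ∀ w : EuclideanSpace ℝ (Fin n) → ℝ, MemApq p q w →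
      ∀ f : EuclideanSpace ℝ (Fin n) → ℂ, MemWeightedLp p w f →
        (∀ᵐ x, RieszConverges α f x) ∧ WeakBound α p q (1 - α / n) c w f := by
  obtain ⟨c, hc⟩ : ∃ c : ℝ≥0, ∀ w : EuclideanSpace ℝ (Fin n) → ℝ, Measurable w →
      (∀ x, 0 < w x) → apqConst p q w < ∞ →
      ∀ f : EuclideanSpace ℝ (Fin n) → ℂ, MemWeightedLp p w f →
        (∀ᵐ x ∂volume.withDensity (wpow w q), RieszConverges α f x) ∧
          WeakBound α p q (1 - α / n) c w f := by
    rcases hp.eq_or_lt with rfl | hp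
    · rw [div_one] at hq
      exact ⟨_, fun w hw hpos hA f hf => weakBound_one_of_measurable hα hαn hq hw hpos hA hf⟩
    · exact exists_weakBound_of_measurable hα hαn hp hpα hq
  refine ⟨c, fun w hw f hf => ?_⟩
  obtain ⟨w₀, hw₀, hpos, hae⟩ := hw.exists_measurable_pos
  have hfae : (fun x => (w x : ℂ) * f x) =ᵐ[volume] fun x => (w₀ x : ℂ) * f x := by
    filter_upwards [hae] with x hx
    rw [hx]
  have hA := hw.const_lt_top
  rw [apqConst_congr hae] at hA
  obtain ⟨h1, h2⟩ := hc w₀ hw₀ hpos hA f (hf.ae_eq hfae)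
  constructor
  · rw [ae_withDensity_iff (measurable_wpow hw₀ q)] at h1
    exact h1.mono fun x hx => hx (wpow_ne_zero hpos q x)
  · rw [WeakBound, weightedLpNorm, eLpNorm_congr_ae hfae, apqConst_congr hae, weakNorm,
      withDensity_congr_ae (wpow_congr hae q)]
    exact h2

end UpperBound

/-! ### Integrals and averages of powers of the norm. -/

section Radial

variable {n : ℕ}

/-- The surface measure of the unit sphere of `ℝⁿ`. -/
def sphereArea (n : ℕ) : ℝ := n * volume.real (ball (0 : EuclideanSpace ℝ (Fin n)) 1)

theorem sphereArea_pos (hn : 0 < n) : 0 < sphereArea n :=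
  mul_pos (by exact_mod_cast hn)
    (ENNReal.toReal_pos (measure_ball_pos _ _ one_pos).ne' measure_ball_lt_top.ne)

theorem lintegral_ball_norm_rpow (hn : 0 < n) {δ R : ℝ} (hδ : 0 < δ) (hR : 0 ≤ R) :
    ∫⁻ x in ball (0 : EuclideanSpace ℝ (Fin n)) R, ENNReal.ofReal (‖x‖ ^ (δ - n)) =
      ENNReal.ofReal (sphereArea n * (R ^ δ / δ)) := by
  have : Nontrivial (EuclideanSpace ℝ (Fin n)) := by
    have : Nonempty (Fin n) := ⟨⟨0, hn⟩⟩
    infer_instance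
  have hpow : ∀ y : ℝ, 0 < y → y ^ (n - 1) • y ^ (δ - n) = y ^ (δ - 1) := by
    intro y hy
    rw [smul_eq_mul, ← Real.rpow_natCast, ← Real.rpow_add hy, Nat.cast_sub hn]
    congr 1
    push_cast
    ring
  have hint : IntervalIntegrable (fun y : ℝ => y ^ (δ - 1)) volume 0 R :=
    intervalIntegral.intervalIntegrable_rpow' (by linarith)
  have hI : IntegrableOn (fun x : EuclideanSpace ℝ (Fin n) => ‖x‖ ^ (δ - n)) (ball 0 R) := by
    rw [integrableOn_fun_norm_addHaar volume (f := fun y => y ^ (δ - n)),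
      finrank_euclideanSpace_fin, integrableOn_congr_fun (fun y hy => hpow y hy.1)
        measurableSet_Ioo]
    rw [intervalIntegrable_iff_integrableOn_Ioo_of_le hR] at hint
    exact hint
  rw [← ofReal_integral_eq_lintegral_ofReal hI
    (Filter.Eventually.of_forall fun x => Real.rpow_nonneg (norm_nonneg _) _)]
  congr 1
  have h1 : ∫ x in ball (0 : EuclideanSpace ℝ (Fin n)) R, ‖x‖ ^ (δ - n) =
      ∫ x : EuclideanSpace ℝ (Fin n), (Iio R).indicator (fun y : ℝ => y ^ (δ - n)) ‖x‖ := by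
    rw [← integral_indicator measurableSet_ball]
    congr 1 with x
    simp [indicator]
  have h2 : ∫ y in Ioi (0 : ℝ), y ^ (n - 1) • (Iio R).indicator (fun y : ℝ => y ^ (δ - n)) y =
      ∫ y in Ioo 0 R, y ^ (δ - 1) := by
    rw [← Ioi_inter_Iio, inter_comm, ← Measure.restrict_restrict measurableSet_Iio,
      ← integral_indicator measurableSet_Iio]
    refine setIntegral_congr_fun measurableSet_Ioi fun y hy => ?_
    by_cases hyR : y < R
    · simp [indicator, hyR, ← hpow y hy]
    · simp [indicator, hyR]
  rw [h1, integral_fun_norm_addHaar, finrank_euclideanSpace_fin, h2,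
    ← integral_Ioc_eq_integral_Ioo, ← intervalIntegral.integral_of_le hR,
    integral_rpow (Or.inl (by linarith)), sub_add_cancel, Real.zero_rpow hδ.ne', sub_zero,
    nsmul_eq_mul, smul_eq_mul, sphereArea]
  ring

theorem dist_le_of_mem_cube {a x : EuclideanSpace ℝ (Fin n)} {l : ℝ} (hl : 0 < l)
    (hx : x ∈ cube a l) : dist x a ≤ √n * l := by
  rw [EuclideanSpace.dist_eq]
  refine Real.sqrt_le_iff.2 ⟨by positivity, ?_⟩
  rw [mul_pow, Real.sq_sqrt n.cast_nonneg]
  calc ∑ i, dist (x.ofLp i) (a.ofLp i) ^ 2 ≤ ∑ _i : Fin n, l ^ 2 := by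
        refine Finset.sum_le_sum fun i _ => ?_
        have := hx i
        rw [Real.dist_eq]
        gcongr
        exact abs_le.2 ⟨by linarith [this.1], by linarith [this.2]⟩
    _ = n * l ^ 2 := by simp

/-- The power weight `|x|^(δ - n)` is an `A₁` weight, with constant of order `1 / δ`. -/
theorem exists_avg_norm_rpow_le (hn : 0 < n) :
    ∃ C : ℝ, 0 < C ∧ ∀ δ : ℝ, 0 < δ → δ < 1 → ∀ (a : EuclideanSpace ℝ (Fin n)) (l : ℝ), 0 < l →
      ∃ m : ℝ, 0 < m ∧
        avg (cube a l) (fun x => ENNReal.ofReal (‖x‖ ^ (δ - n))) ≤ ENNReal.ofReal (C / δ * m) ∧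
        ∀ x ∈ cube a l, x ≠ 0 → m ≤ ‖x‖ ^ (δ - n) := by
  have hn1 : (1 : ℝ) ≤ n := by exact_mod_cast hn
  have hA := sphereArea_pos hn
  refine ⟨3 ^ n + sphereArea n * (3 * √n) ^ n, by positivity, fun δ hδ hδ1 a l hl => ?_⟩
  have hD : 0 < √(n : ℝ) := Real.sqrt_pos.2 (by linarith)
  have hexp : δ - n ≤ 0 := by linarith
  set ρ : ℝ := ‖a‖ + √n * l with hρ
  have hρ0 : 0 < ρ := by positivity
  have hup : ∀ x ∈ cube a l, ‖x‖ ≤ ρ := fun x hx => by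
    have h1 := dist_le_of_mem_cube hl hx
    rw [dist_eq_norm] at h1
    linarith [norm_sub_norm_le x a]
  -- The norm is at most `ρ` on the cube. The origin is excluded because `0 ^ (δ - n) = 0` for real
  -- powers.
  refine ⟨ρ ^ (δ - n), by positivity, ?_, fun x hx hx0 =>
    Real.rpow_le_rpow_of_nonpos (norm_pos_iff.2 hx0) (hup x hx) hexp⟩
  have hl0 : ENNReal.ofReal l ^ n ≠ 0 := pow_ne_zero _ (by simpa using hl)
  have hlt : ENNReal.ofReal l ^ n ≠ ∞ := by finiteness
  have hsum : ∀ b : ℝ, b ≤ (3 ^ n + sphereArea n * (3 * √n) ^ n) / δ →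
      ENNReal.ofReal (b * ρ ^ (δ - n)) ≤
        ENNReal.ofReal ((3 ^ n + sphereArea n * (3 * √n) ^ n) / δ * ρ ^ (δ - n)) := by
    intro b hb
    gcongr
  -- Far from the origin the norm is comparable to `ρ` on the cube. Otherwise the cube lies in a
  -- centered ball of comparable size, and the integral over that ball produces the factor `1 / δ`.
  rcases le_or_gt (2 * (√n * l)) ‖a‖ with hfar | hnear
  · refine le_trans ?_ (hsum (3 ^ n) ?_)
    · have hpt : ∀ x ∈ cube a l, ENNReal.ofReal (‖x‖ ^ (δ - n)) ≤
          ENNReal.ofReal (3 ^ n * ρ ^ (δ - n)) := by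
        intro x hx
        have h1 := dist_le_of_mem_cube hl hx
        rw [dist_eq_norm] at h1
        have h2 : ρ / 3 ≤ ‖x‖ := by
          have := norm_sub_norm_le a x
          rw [norm_sub_rev] at this
          linarith
        refine ENNReal.ofReal_le_ofReal ?_
        calc ‖x‖ ^ (δ - n) ≤ (ρ / 3) ^ (δ - n) :=
              Real.rpow_le_rpow_of_nonpos (by positivity) h2 hexp
          _ = 3 ^ ((n : ℝ) - δ) * ρ ^ (δ - n) := by
              rw [Real.div_rpow hρ0.le (by norm_num), div_eq_mul_inv, ← Real.rpow_neg (by norm_num),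
                neg_sub, mul_comm]
          _ ≤ 3 ^ (n : ℝ) * ρ ^ (δ - n) := by
              gcongr
              · norm_num
              · linarith
          _ = _ := by rw [Real.rpow_natCast]
      calc avg (cube a l) (fun x => ENNReal.ofReal (‖x‖ ^ (δ - n)))
          ≤ (volume (cube a l))⁻¹ * ∫⁻ _x in cube a l, ENNReal.ofReal (3 ^ n * ρ ^ (δ - n)) :=
            mul_le_mul_right (setLIntegral_mono' (measurableSet_cube a l) hpt) _
        _ = ENNReal.ofReal (3 ^ n * ρ ^ (δ - n)) := by
            rw [setLIntegral_const, volume_cube, mul_left_comm, ENNReal.inv_mul_cancel hl0 hlt,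
              mul_one]
    · rw [le_div_iff₀ hδ]
      calc (3 : ℝ) ^ n * δ ≤ 3 ^ n * 1 := by gcongr
        _ ≤ _ := by
            rw [mul_one]
            exact le_add_of_nonneg_right (by positivity)
  · have hρ3 : ρ < 3 * √n * l := by
      rw [hρ]
      linarith
    refine le_trans ?_ (hsum (sphereArea n * (3 * √n) ^ n / δ) ?_)
    · have hsub : cube a l ⊆ ball 0 (3 * √n * l) := fun x hx => by
        rw [mem_ball_zero_iff]
        exact (hup x hx).trans_lt hρ3
      rw [avg, volume_cube]
      calc (ENNReal.ofReal l ^ n)⁻¹ * ∫⁻ x in cube a l, ENNReal.ofReal (‖x‖ ^ (δ - n))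
          ≤ (ENNReal.ofReal l ^ n)⁻¹ *
              ENNReal.ofReal (sphereArea n * ((3 * √n * l) ^ δ / δ)) := by
            rw [← lintegral_ball_norm_rpow hn hδ (by positivity)]
            gcongr
        _ = ENNReal.ofReal ((l ^ n)⁻¹ * (sphereArea n * ((3 * √n * l) ^ δ / δ))) := by
            rw [← ENNReal.ofReal_pow hl.le, ← ENNReal.ofReal_inv_of_pos (by positivity),
              ← ENNReal.ofReal_mul (by positivity)]
        _ = ENNReal.ofReal (sphereArea n * (3 * √n) ^ n / δ * (3 * √n * l) ^ (δ - n)) := by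
            congr 1
            rw [Real.rpow_sub (by positivity), Real.rpow_natCast, mul_pow _ l]
            field_simp
        _ ≤ _ := by
            refine ENNReal.ofReal_le_ofReal ?_
            refine mul_le_mul_of_nonneg_left ?_ (by positivity)
            exact Real.rpow_le_rpow_of_nonpos hρ0 hρ3.le hexp
    · gcongr
      exact le_add_of_nonneg_left (by positivity)

end Radial

/-! ### Sharpness of the exponent through power weights. -/

section PowerWeights

variable {n : ℕ} {α : ℝ}

/-- A weight whose power `w ^ q` is an `A₁` weight with constant `C` is in `A_{p,q}`, with
constant at most `C`. -/
theorem apqConst_le_of_A_one {p q : ℝ} (hp : 1 ≤ p) (hq : 0 < q)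
    {w : EuclideanSpace ℝ (Fin n) → ℝ} {C : ℝ≥0∞}
    (h : ∀ (a : EuclideanSpace ℝ (Fin n)) (l : ℝ), 0 < l → ∃ m : ℝ≥0∞, m ≠ 0 ∧ m ≠ ∞ ∧
      avg (cube a l) (wpow w q) ≤ C * m ∧ ∀ᵐ x, x ∈ cube a l → m ≤ wpow w q x) :
    apqConst p q w ≤ C := by
  rcases hp.eq_or_lt with rfl | hp
  · rw [apqConst, if_pos rfl]
    refine sInf_le fun a l hl => ?_
    obtain ⟨m, -, -, hm, hae⟩ := h a l hl
    refine hm.trans (mul_le_mul_right (le_essInf_of_ae_le m ?_) _)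
    exact (ae_restrict_iff' (measurableSet_cube a l)).2 hae
  · rw [apqConst, if_neg hp.ne']
    refine iSup_le fun a => iSup₂_le fun l hl => ?_
    have hp'0 : 0 < p.conjExponent := (Real.HolderConjugate.conjExponent hp).symm.pos
    set p' := p.conjExponent with hp'
    obtain ⟨m, hm0, hmt, hm, hae⟩ := h a l hl
    have hl0 : ENNReal.ofReal l ^ n ≠ 0 := pow_ne_zero _ (by simpa using hl)
    have hlt : ENNReal.ofReal l ^ n ≠ ∞ := by finiteness
    have h1 : avg (cube a l) (wpow w (-p')) ≤ m ^ (-(p' / q)) := by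
      calc avg (cube a l) (wpow w (-p'))
          ≤ (volume (cube a l))⁻¹ * ∫⁻ _x in cube a l, m ^ (-(p' / q)) := by
            refine mul_le_mul_right (lintegral_mono_ae ?_) _
            refine (ae_restrict_iff' (measurableSet_cube a l)).2 ?_
            filter_upwards [hae] with x hx hxQ
            have : wpow w (-p') x = wpow w q x ^ (-(p' / q)) := by
              rw [wpow_rpow]
              congr 1
              field_simp
            rw [this]
            rw [ENNReal.rpow_neg, ENNReal.rpow_neg, ENNReal.inv_le_inv]
            exact ENNReal.rpow_le_rpow (hx hxQ) (by positivity)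
        _ = m ^ (-(p' / q)) := by
            rw [setLIntegral_const, volume_cube, mul_left_comm, ENNReal.inv_mul_cancel hl0 hlt,
              mul_one]
    calc avg (cube a l) (wpow w q) * avg (cube a l) (wpow w (-p')) ^ (q / p')
        ≤ C * m * (m ^ (-(p' / q))) ^ (q / p') := by gcongr
      _ = C := by
          rw [← ENNReal.rpow_mul]
          have : -(p' / q) * (q / p') = -1 := by field_simp
          rw [this, ENNReal.rpow_neg_one, mul_assoc, ENNReal.mul_inv_cancel hm0 hmt, mul_one]

/-- Nonnegativity rules out cancellation. Convergence is needed because a divergent Bochner integral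
has the value `0`. -/
theorem enorm_rieszPotential_ofReal {h : EuclideanSpace ℝ (Fin n) → ℝ} (hh : ∀ y, 0 ≤ h y)
    {x : EuclideanSpace ℝ (Fin n)} (hx : RieszConverges α (fun y => (h y : ℂ)) x) :
    ‖rieszPotential α (fun y => (h y : ℂ)) x‖ₑ = rieszMajorant α (fun y => (h y : ℂ)) x := by
  have h1 := ofReal_integral_norm_eq_lintegral_enorm hx
  simp_rw [enorm_div_eq_mul_rieszKernel (fun y => (h y : ℂ)) x] at h1
  rw [rieszMajorant, ← h1]
  have h2 : rieszPotential α (fun y => (h y : ℂ)) x =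
      ((∫ y, ‖(h y : ℂ) / ((‖x - y‖ ^ ((n : ℝ) - α) : ℝ) : ℂ)‖ : ℝ) : ℂ) := by
    rw [rieszPotential, ← integral_complex_ofReal]
    congr 1 with y
    rw [← Complex.ofReal_div, Complex.norm_real, Real.norm_of_nonneg]
    exact div_nonneg (hh y) (by positivity)
  rw [h2, ← ofReal_norm, Complex.norm_real, Real.norm_of_nonneg]
  exact integral_nonneg fun y => norm_nonneg _

/-- The weights that show the sharpness of the exponent. -/
def powerWeight (n : ℕ) (q δ : ℝ) (x : EuclideanSpace ℝ (Fin n)) : ℝ := ‖x‖ ^ ((δ - n) / q)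

/-- The functions that show the sharpness of the exponent. -/
def powerFun (n : ℕ) (α δ : ℝ) (x : EuclideanSpace ℝ (Fin n)) : ℝ :=
  (ball 0 1).indicator (fun x => ‖x‖ ^ (δ - α)) x

theorem powerFun_nonneg (δ : ℝ) (x : EuclideanSpace ℝ (Fin n)) : 0 ≤ powerFun n α δ x :=
  indicator_nonneg (fun _ _ => by positivity) x

theorem measurable_powerFun (δ : ℝ) : Measurable (powerFun n α δ) :=
  Measurable.indicator (by fun_prop) measurableSet_ball

theorem measurable_powerWeight (q δ : ℝ) : Measurable (powerWeight n q δ) := by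
  unfold powerWeight
  fun_prop

theorem ae_ne_zero (hn : 0 < n) : ∀ᵐ x : EuclideanSpace ℝ (Fin n), x ≠ 0 := by
  have : Nontrivial (EuclideanSpace ℝ (Fin n)) := by
    have : Nonempty (Fin n) := ⟨⟨0, hn⟩⟩
    infer_instance
  exact Measure.ae_ne volume 0

theorem powerWeight_pos (hn : 0 < n) (q δ : ℝ) :
    ∀ᵐ x : EuclideanSpace ℝ (Fin n), 0 < powerWeight n q δ x := by
  filter_upwards [ae_ne_zero hn] with x hx
  exact Real.rpow_pos_of_pos (norm_pos_iff.2 hx) _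

theorem wpow_powerWeight {q : ℝ} (hq : 0 < q) (δ : ℝ) {x : EuclideanSpace ℝ (Fin n)}
    (hx : x ≠ 0) : wpow (powerWeight n q δ) q x = ENNReal.ofReal (‖x‖ ^ (δ - n)) := by
  rw [wpow, powerWeight, ENNReal.ofReal_rpow_of_pos (Real.rpow_pos_of_pos (norm_pos_iff.2 hx) _),
    ← Real.rpow_mul (norm_nonneg _), div_mul_cancel₀ _ hq.ne']

theorem wpow_powerWeight_ae (hn : 0 < n) {q : ℝ} (hq : 0 < q) (δ : ℝ) :
    wpow (powerWeight n q δ) q =ᵐ[volume] fun x => ENNReal.ofReal (‖x‖ ^ (δ - n)) := by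
  filter_upwards [ae_ne_zero hn] with x hx
  exact wpow_powerWeight hq δ hx

theorem exists_apqConst_powerWeight_le (hn : 0 < n) {p q : ℝ} (hp : 1 ≤ p) (hq : 0 < q) :
    ∃ C : ℝ, 0 < C ∧ ∀ δ : ℝ, 0 < δ → δ < 1 →
      apqConst p q (powerWeight n q δ) ≤ ENNReal.ofReal (C / δ) := by
  obtain ⟨C, hC0, hC⟩ := exists_avg_norm_rpow_le hn
  refine ⟨C, hC0, fun δ hδ hδ1 => apqConst_le_of_A_one hp hq fun a l hl => ?_⟩
  obtain ⟨m, hm0, hm, hx⟩ := hC δ hδ hδ1 a l hl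
  refine ⟨ENNReal.ofReal m, by simpa using hm0, ENNReal.ofReal_ne_top, ?_, ?_⟩
  · rw [avg_congr (wpow_powerWeight_ae hn hq δ), ← ENNReal.ofReal_mul (by positivity)]
    exact hm
  · filter_upwards [ae_ne_zero hn] with x hx0 hxQ
    rw [wpow_powerWeight hq δ hx0]
    exact ENNReal.ofReal_le_ofReal (hx x hxQ hx0)

theorem weightedLpNorm_powerFun_le (hn : 0 < n) {p q δ : ℝ} (hp : 1 ≤ p) (hq0 : 0 < q)
    (hq : 1 / q = 1 / p - α / n) (hδ : 0 < δ) :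
    weightedLpNorm p (powerWeight n q δ) (fun x => (powerFun n α δ x : ℂ)) ≤
      ENNReal.ofReal (sphereArea n / δ) ^ (1 / p) := by
  have hp0 : 0 < p := one_pos.trans_le hp
  have hn0 : (0 : ℝ) < n := by exact_mod_cast hn
  have hA := sphereArea_pos hn
  rw [weightedLpNorm_eq (w := powerWeight n q δ) hp0 fun x => Real.rpow_nonneg (norm_nonneg x) _]
  refine ENNReal.rpow_le_rpow ?_ (by positivity)
  -- The relation between `p` and `q` makes `(w f)^p` equal to `|x|^(δ'-n)` on the unit ball; `δ' ≥
  -- δ` is all that is needed.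
  set δ' : ℝ := δ * (p * (1 + 1 / q)) with hδ'
  have hδδ' : δ ≤ δ' := by
    have h1 : 1 ≤ 1 + 1 / q := le_add_of_nonneg_right (by positivity)
    have : 1 ≤ p * (1 + 1 / q) := by nlinarith
    exact le_mul_of_one_le_right hδ.le this
  have hδ'0 : 0 < δ' := hδ.trans_le hδδ'
  calc ∫⁻ x, (‖(powerFun n α δ x : ℂ)‖ₑ * ENNReal.ofReal (powerWeight n q δ x)) ^ p
      = ∫⁻ x in ball (0 : EuclideanSpace ℝ (Fin n)) 1, ENNReal.ofReal (‖x‖ ^ (δ' - n)) := by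
        rw [← lintegral_indicator measurableSet_ball]
        refine lintegral_congr_ae ?_
        filter_upwards [ae_ne_zero hn] with x hx0
        have hx0 : 0 < ‖x‖ := norm_pos_iff.2 hx0
        by_cases hx : x ∈ ball (0 : EuclideanSpace ℝ (Fin n)) 1
        · rw [indicator_of_mem hx, powerFun, indicator_of_mem hx, powerWeight, ← ofReal_norm,
            Complex.norm_real, Real.norm_of_nonneg (by positivity),
            ← ENNReal.ofReal_mul (by positivity), ← Real.rpow_add hx0,
            ENNReal.ofReal_rpow_of_pos (by positivity), ← Real.rpow_mul hx0.le]
          congr 2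
          have h1 : (1 : ℝ) / p = 1 / q + α / n := by linarith
          have h2 : p * (1 / q + α / n) = 1 := by rw [← h1, mul_one_div_cancel hp0.ne']
          have h3 : (n : ℝ) * (α / n) = α := mul_div_cancel₀ _ hn0.ne'
          calc (δ - α + (δ - n) / q) * p = δ * (p * (1 + 1 / q)) - (p * (1 / q) * n + p * α) := by
                ring
            _ = δ' - n * (p * (1 / q + α / n)) := by
                rw [hδ']
                nth_rewrite 1 [← h3]
                ring
            _ = δ' - n := by rw [h2, mul_one]
        · rw [indicator_of_notMem hx, powerFun, indicator_of_notMem hx]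
          simp [hp0]
    _ = ENNReal.ofReal (sphereArea n * (1 ^ δ' / δ')) :=
        lintegral_ball_norm_rpow hn hδ'0 zero_le_one
    _ ≤ ENNReal.ofReal (sphereArea n / δ) := by
        rw [Real.one_rpow, mul_one_div]
        gcongr

/-- The radius `r = 2^(-1/δ)` satisfies `r^δ = 1/2`, so half of the integral of `|y|^(δ-n)` over the
unit ball comes from `|y| ≥ r`. There `|x - y| ≤ 2|y|`, so the integrand of the potential is at
least `2^(α-n) |y|^(δ-n)`. -/
theorem le_rieszMajorant_powerFun (hn : 0 < n) (hαn : α < n) {δ : ℝ} (hδ : 0 < δ)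
    {x : EuclideanSpace ℝ (Fin n)} (hx : ‖x‖ < (1 / 2 : ℝ) ^ δ⁻¹) :
    ENNReal.ofReal (2 ^ (α - n) * (sphereArea n / (2 * δ))) ≤
      rieszMajorant α (fun y => (powerFun n α δ y : ℂ)) x := by
  have hA := sphereArea_pos hn
  set r : ℝ := (1 / 2 : ℝ) ^ δ⁻¹ with hr
  have hr0 : 0 < r := by positivity
  have hr1 : r ≤ 1 := Real.rpow_le_one (by norm_num) (by norm_num) (by positivity)
  have hrδ : r ^ δ = 1 / 2 := by
    rw [hr, ← Real.rpow_mul (by norm_num), inv_mul_cancel₀ hδ.ne', Real.rpow_one]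
  have hsub : ball (0 : EuclideanSpace ℝ (Fin n)) r ⊆ ball 0 1 := ball_subset_ball hr1
  have hdiff : ∫⁻ y in ball (0 : EuclideanSpace ℝ (Fin n)) 1 \ ball 0 r,
      ENNReal.ofReal (‖y‖ ^ (δ - n)) = ENNReal.ofReal (sphereArea n / (2 * δ)) := by
    have h1 := lintegral_inter_add_sdiff (μ := volume)
      (fun y : EuclideanSpace ℝ (Fin n) => ENNReal.ofReal (‖y‖ ^ (δ - n))) (ball 0 1)
      (measurableSet_ball (x := (0 : EuclideanSpace ℝ (Fin n))) (ε := r))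
    rw [inter_eq_right.2 hsub, lintegral_ball_norm_rpow hn hδ hr0.le,
      lintegral_ball_norm_rpow hn hδ zero_le_one, hrδ, Real.one_rpow] at h1
    have h2 : sphereArea n * (1 / δ) = sphereArea n * (1 / 2 / δ) + sphereArea n / (2 * δ) := by
      field_simp
      norm_num
    rw [h2, ENNReal.ofReal_add (by positivity) (by positivity)] at h1
    exact (ENNReal.add_right_inj ENNReal.ofReal_ne_top).1 h1
  rw [ENNReal.ofReal_mul (by positivity), ← hdiff,
    ← lintegral_const_mul' _ _ ENNReal.ofReal_ne_top]
  refine (setLIntegral_mono' (measurableSet_ball.diff measurableSet_ball) fun y hy => ?_).trans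
    (setLIntegral_le_lintegral _ _)
  have hy1 : y ∈ ball (0 : EuclideanSpace ℝ (Fin n)) 1 := hy.1
  have hyr : r ≤ ‖y‖ := by simpa using hy.2
  have hy0 : 0 < ‖y‖ := hr0.trans_le hyr
  have hd : 0 < (n : ℝ) - α := sub_pos.2 hαn
  have hxy : 0 < ‖x - y‖ := by
    rw [norm_pos_iff, sub_ne_zero]
    rintro rfl
    linarith
  have hxy2 : ‖x - y‖ ≤ 2 * ‖y‖ := by linarith [norm_sub_le x y]
  dsimp only
  rw [powerFun, indicator_of_mem hy1, ← ofReal_norm, Complex.norm_real,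
    Real.norm_of_nonneg (by positivity), rieszKernel, ← ENNReal.ofReal_mul (by positivity),
    ← ENNReal.ofReal_mul (by positivity)]
  refine ENNReal.ofReal_le_ofReal ?_
  calc (2 : ℝ) ^ (α - n) * ‖y‖ ^ (δ - n) = ‖y‖ ^ (δ - α) * ((2 * ‖y‖) ^ ((n : ℝ) - α))⁻¹ := by
        rw [← Real.rpow_neg (by positivity), neg_sub, Real.mul_rpow (by norm_num) hy0.le,
          mul_left_comm, ← Real.rpow_add hy0]
        congr 2
        ring
    _ ≤ _ := by gcongr

theorem le_weakNorm_powerFun (hn : 0 < n) (hαn : α < n) {q δ : ℝ} (hq : 0 < q) (hδ : 0 < δ)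
    (hconv : ∀ᵐ x, RieszConverges α (fun y : EuclideanSpace ℝ (Fin n) => (powerFun n α δ y : ℂ)) x) :
    ENNReal.ofReal (2 ^ (α - n) * (sphereArea n / (4 * δ))) *
        ENNReal.ofReal (sphereArea n / (2 * δ)) ^ (1 / q) ≤
      weakNorm q (wpow (powerWeight n q δ) q)
        (rieszPotential α fun y => (powerFun n α δ y : ℂ)) := by
  have hA := sphereArea_pos hn
  -- Half the lower bound for the potential, which gives the strict inequality in the superlevel
  -- set.
  set t : ℝ := 2 ^ (α - n) * (sphereArea n / (4 * δ)) with ht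
  have hr0 : 0 ≤ (1 / 2 : ℝ) ^ δ⁻¹ := by positivity
  have hball : volume.withDensity (wpow (powerWeight n q δ) q)
      (ball 0 ((1 / 2 : ℝ) ^ δ⁻¹)) = ENNReal.ofReal (sphereArea n / (2 * δ)) := by
    rw [withDensity_congr_ae (wpow_powerWeight_ae hn hq δ), withDensity_apply',
      lintegral_ball_norm_rpow hn hδ hr0, ← Real.rpow_mul (by norm_num), inv_mul_cancel₀ hδ.ne',
      Real.rpow_one]
    congr 1
    field_simp
  rw [← hball]
  refine le_trans ?_ (le_iSup _ t.toNNReal)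
  refine mul_le_mul_right (ENNReal.rpow_le_rpow (measure_mono_ae ?_) (by positivity)) _
  filter_upwards [(withDensity_absolutelyContinuous _ _).ae_le hconv] with x hx hxb
  have hxb : ‖x‖ < (1 / 2 : ℝ) ^ δ⁻¹ := by simpa using mem_ball_zero_iff.1 hxb
  have h1 := le_rieszMajorant_powerFun hn hαn hδ hxb
  rw [← enorm_rieszPotential_ofReal (powerFun_nonneg δ) hx] at h1
  have h2 : ENNReal.ofReal t < ENNReal.ofReal (2 ^ (α - n) * (sphereArea n / (2 * δ))) := by
    rw [ENNReal.ofReal_lt_ofReal_iff (by positivity), ht]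
    gcongr
    norm_num
  have h3 := h2.trans_le h1
  rw [enorm_eq_nnnorm, ENNReal.ofReal] at h3
  exact_mod_cast h3

/-- The exponent `1 - α / n` in the weak type bound cannot be lowered. -/
theorem not_exists_weakBound (hα : 0 < α) (hαn : α < n) {p q γ : ℝ} (hp : 1 ≤ p)
    (hpα : p < n / α) (hq : 1 / q = 1 / p - α / n) (hγ : γ < 1 - α / n) :
    ¬ ∃ c : ℝ≥0, ∀ w : EuclideanSpace ℝ (Fin n) → ℝ, MemApq p q w →
      ∀ f : EuclideanSpace ℝ (Fin n) → ℂ, MemWeightedLp p w f → WeakBound α p q γ c w f := by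
  rintro ⟨c, hc⟩
  have hn0 : (0 : ℝ) < n := hα.trans hαn
  have hn : 0 < n := by exact_mod_cast hn0
  have hp0 : 0 < p := one_pos.trans_le hp
  have hq0 : 0 < q := by
    refine one_div_pos.1 (hq ▸ sub_pos.2 ?_)
    rw [← inv_div, ← one_div]
    exact one_div_lt_one_div_of_lt hp0 hpα
  have hK := sphereArea_pos hn
  set K := sphereArea n with hKdef
  -- Only the almost everywhere convergence is used from the positive result.
  obtain ⟨c₁, hc₁⟩ := exists_weakBound hα hαn hp hpα hq
  obtain ⟨C, hC0, hC⟩ := exists_apqConst_powerWeight_le hn hp hq0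
  -- Only an upper bound for the `A_{p,q}` constant is at hand, so the exponent has to be
  -- nonnegative. Raising it is harmless because the constant is at least `1`.
  set γ' := max γ 0 with hγ'
  have hγ'0 : 0 ≤ γ' := le_max_right _ _
  have hγ'1 : γ' < 1 - α / n := max_lt hγ (sub_pos.2 ((div_lt_one hn0).2 hαn))
  have hmain : ∀ δ : ℝ, 0 < δ → δ < 1 →
      2 ^ (α - n) * (K / (4 * δ)) * (K / (2 * δ)) ^ (1 / q) ≤
        c * (C / δ) ^ γ' * (K / δ) ^ (1 / p) := by
    intro δ hδ hδ1
    set w := powerWeight n q δ with hw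
    set f : EuclideanSpace ℝ (Fin n) → ℂ := fun x => (powerFun n α δ x : ℂ) with hf
    have hwm : Measurable w := measurable_powerWeight q δ
    have hA : apqConst p q w ≤ ENNReal.ofReal (C / δ) := hC δ hδ hδ1
    have hmem : MemApq p q w :=
      ⟨hwm.aemeasurable, powerWeight_pos hn q δ, hA.trans_lt ENNReal.ofReal_lt_top⟩
    have hnorm := weightedLpNorm_powerFun_le (α := α) hn hp hq0 hq hδ
    have hfLp : MemWeightedLp p w f := by
      refine ⟨?_, hnorm.trans_lt (ENNReal.rpow_lt_top_of_nonneg (by positivity)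
        ENNReal.ofReal_ne_top)⟩
      exact ((Complex.measurable_ofReal.comp hwm).mul
        (Complex.measurable_ofReal.comp (measurable_powerFun δ))).aestronglyMeasurable
    have hA1 : 1 ≤ apqConst p q w := by
      obtain ⟨w₀, hw₀, hpos, hae⟩ := hmem.exists_measurable_pos
      rw [apqConst_congr hae]
      exact one_le_apqConst hp hq0 hw₀ hpos
    have h1 := (le_weakNorm_powerFun hn hαn hq0 hδ (hc₁ w hmem f hfLp).1).trans
      (hc w hmem f hfLp)
    have h2 : (c : ℝ≥0∞) * apqConst p q w ^ γ * weightedLpNorm p w f ≤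
        c * ENNReal.ofReal (C / δ) ^ γ' * ENNReal.ofReal (K / δ) ^ (1 / p) := by
      refine mul_le_mul' (mul_le_mul_right ?_ _) hnorm
      exact (ENNReal.rpow_le_rpow_of_exponent_le hA1 (le_max_left _ _)).trans
        (ENNReal.rpow_le_rpow hA hγ'0)
    have h3 := h1.trans h2
    rw [ENNReal.ofReal_rpow_of_pos (by positivity), ENNReal.ofReal_rpow_of_pos (by positivity),
      ENNReal.ofReal_rpow_of_pos (by positivity), ← ENNReal.ofReal_coe_nnreal,
      ← ENNReal.ofReal_mul (by positivity), ← ENNReal.ofReal_mul (by positivity),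
      ← ENNReal.ofReal_mul (by positivity), ENNReal.ofReal_le_ofReal_iff (by positivity)] at h3
    exact h3
  set X : ℝ := 2 ^ (α - n) * (K / 4) * (K / 2) ^ (1 / q) with hX
  set Y : ℝ := c * C ^ γ' * K ^ (1 / p) with hY
  set η : ℝ := 1 - α / n - γ' with hη
  have hη0 : 0 < η := sub_pos.2 hγ'1
  have hXpos : 0 < X := by positivity
  -- The powers of `δ` compare through `1 + 1/q = η + γ' + 1/p`. As `η > 0`, letting `δ → 0` forces
  -- `X ≤ 0`.
  have hbound : ∀ δ : ℝ, 0 < δ → δ < 1 → X ≤ Y * δ ^ η := by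
    intro δ hδ hδ1
    have h1 := hmain δ hδ hδ1
    have e1 : 2 ^ (α - n) * (K / (4 * δ)) * (K / (2 * δ)) ^ (1 / q) =
        X * (δ ^ (1 + 1 / q))⁻¹ := by
      rw [← div_div, ← div_div, Real.div_rpow (x := K / 2) (by positivity) hδ.le,
        Real.rpow_add hδ, Real.rpow_one, hX]
      field_simp
    have e2 : c * (C / δ) ^ γ' * (K / δ) ^ (1 / p) = Y * (δ ^ (γ' + 1 / p))⁻¹ := by
      rw [Real.div_rpow hC0.le hδ.le, Real.div_rpow hK.le hδ.le, Real.rpow_add hδ, hY]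
      field_simp
    have e3 : δ ^ (1 + 1 / q) = δ ^ η * δ ^ (γ' + 1 / p) := by
      rw [← Real.rpow_add hδ]
      congr 1
      rw [hη, hq]
      ring
    rw [e1, e2, e3] at h1
    have hP : 0 < δ ^ (γ' + 1 / p) := by positivity
    have hE : 0 < δ ^ η := by positivity
    rw [← div_eq_mul_inv, ← div_eq_mul_inv, div_le_div_iff₀ (by positivity) hP] at h1
    exact le_of_mul_le_mul_right (h1.trans_eq (mul_assoc _ _ _).symm) hP
  have hlim : Filter.Tendsto (fun δ : ℝ => Y * δ ^ η) (nhdsWithin 0 (Ioi 0)) (nhds 0) := by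
    have h1 : Filter.Tendsto (fun δ : ℝ => Y * δ ^ η) (nhds 0) (nhds (Y * 0 ^ η)) :=
      ((Real.continuousAt_rpow_const 0 η (Or.inr hη0.le)).tendsto).const_mul Y
    rw [Real.zero_rpow hη0.ne', mul_zero] at h1
    exact h1.mono_left nhdsWithin_le_nhds
  have hle : X ≤ 0 := by
    refine ge_of_tendsto hlim ?_
    filter_upwards [Ioo_mem_nhdsGT one_pos] with δ hδ
    exact hbound δ hδ.1 hδ.2
  exact hXpos.not_ge hle

end PowerWeights

end FractionalIntegral

end

theorem theorem2p3 (n : ℕ) (α : ℝ) (hα : 0 < α) (hαn : α < n) :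
    (∀ p q : ℝ, 1 ≤ p → p < n / α → 1 / q = 1 / p - α / n →
      (∃ c : ℝ≥0, ∀ w : EuclideanSpace ℝ (Fin n) → ℝ, FractionalIntegral.MemApq p q w →
        ∀ f : EuclideanSpace ℝ (Fin n) → ℂ, FractionalIntegral.MemWeightedLp p w f →
          (∀ᵐ x, FractionalIntegral.RieszConverges α f x) ∧
            FractionalIntegral.WeakBound α p q (1 - α / n) c w f) ∧
      (∀ γ : ℝ, γ < 1 - α / n →
        ¬ ∃ c : ℝ≥0, ∀ w : EuclideanSpace ℝ (Fin n) → ℝ, FractionalIntegral.MemApq p q w →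
          ∀ f : EuclideanSpace ℝ (Fin n) → ℂ, FractionalIntegral.MemWeightedLp p w f →
            FractionalIntegral.WeakBound α p q γ c w f)) ∧
    (∃ c : ℝ≥0, ∀ u : EuclideanSpace ℝ (Fin n) → ℝ, LocallyIntegrable u volume →
      (∀ᵐ x, 0 ≤ u x) →
        ∀ f : EuclideanSpace ℝ (Fin n) → ℂ, AEStronglyMeasurable f volume →
          ∫⁻ x, ‖f x‖ₑ * FractionalIntegral.maximalFunction u x ^ (1 - α / n) < ∞ →
            (∀ᵐ x ∂(volume.withDensity fun x => ENNReal.ofReal (u x)),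
              FractionalIntegral.RieszConverges α f x) ∧
            FractionalIntegral.weakNorm (Real.conjExponent (n / α))
                (fun x => ENNReal.ofReal (u x)) (FractionalIntegral.rieszPotential α f) ≤
              c * ∫⁻ x, ‖f x‖ₑ * FractionalIntegral.maximalFunction u x ^ (1 - α / n)) := by
  refine ⟨fun p q hp hpα hq => ⟨FractionalIntegral.exists_weakBound hα hαn hp hpα hq,
    fun γ hγ => FractionalIntegral.not_exists_weakBound hα hαn hp hpα hq hγ⟩, ?_⟩
  obtain ⟨c, hc⟩ := FractionalIntegral.weakNorm_le_lintegral_maximalFunction hα hαn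
  exact ⟨c, fun u hu _ f hf hfin => hc u hu f hf hfin⟩
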